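/- For real $p,t$ let \[ HH(p,t)=\frac{\bigl(\sin(p\sin t)-(p\sin t)\cos(p\sin t)\bigr)\bigl(e^{p\cos t}+e^{-p\cos t}-2\cos(p\sin t)\bigr)}{\sin(p\sin t)\,\bigl(2\sin t+e^{p\cos t}\sin(-t+p\sin t)-e^{-p\cos t}\sin(t+p\sin t)\bigr)}, \] and for $0<p<\pi$ let \[ H(p)=p-2\log\Bigl(2\cosh\frac p2-\frac2p\sinh\frac p2\Bigr)+\int_0^\pi HH(p,t)\,dt . \] Let also \[ H_\pi=\pi-2\log\Bigl(2\cosh\frac\pi2-\frac2\pi\sinh\frac\pi2\Bigr)+\int_0^\pi\Bigl(HH(\pi,t)-\frac{2}{\cos^2t}\Bigr)\,dt . \] The integrals in these definitions converge, and the following hold. (a) As $p\searrow0$, \[H(p)=p+\tfrac14p^2+\tfrac{23}{864}p^4+O(p^6).\] (b) As $p\nearrow\pi$, \[H(p)=\frac{2\pi^2}{\sqrt{\pi^2-p^2}}+H_\pi+o(1)=\frac{\sqrt2\,\pi^{3/2}}{\sqrt{\pi-p}}+H_\pi+o(1)=p\sqrt{\frac{\pi+p}{\pi-p}}+H_\pi+o(1).\]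 Moreover, the integrand $HH(\pi,t)-2/\cos^2t$ of $H_\pi$ extends, across its removable singularities $t=0,\pi/2,\pi$, to a smooth function of $t\in[0,\pi]$, and numerically $H_\pi=-2.513\ldots$, that is, $-2.514<H_\pi\le-2.513$. (c) For $0<p<\pi$, \[H(p)\le(1+o(1))\,p\sqrt{\frac{\pi+p}{\pi-p}},\] where $o(1)$ denotes a function of $p$ that tends to $0$ both as $p\searrow0$ and as $p\nearrow\pi$. -/

import Mathlib

open Real Set Filter Topology MeasureTheory Asymptotics
open scoped ContDiff

noncomputable section

namespace MagnusHilbert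

/-- The integrand `HH(p,t)` in the norm bound for the logarithm. The quotient is `0/0` at `t = 0`
and `t = π`, and for `p = π` also at `t = π/2`; these finitely many values of `t` do not
influence the integrals below. -/
def HH (p t : ℝ) : ℝ :=
  ((sin (p * sin t) - (p * sin t) * cos (p * sin t)) *
      (exp (p * cos t) + exp (-(p * cos t)) - 2 * cos (p * sin t))) /
    (sin (p * sin t) *
      (2 * sin t + exp (p * cos t) * sin (-t + p * sin t)
        - exp (-(p * cos t)) * sin (t + p * sin t)))

/-- The function `H(p)`, meaningful for `0 < p < π`. -/
def H (p : ℝ) : ℝ :=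
  p - 2 * log (2 * cosh (p / 2) - 2 / p * sinh (p / 2)) + ∫ t in (0 : ℝ)..π, HH p t

/-- The integrand in the definition of the constant `H_π`. -/
def HpiIntegrand (t : ℝ) : ℝ := HH π t - 2 / cos t ^ 2

/-- The constant `H_π`. -/
def Hpi : ℝ :=
  π - 2 * log (2 * cosh (π / 2) - 2 / π * sinh (π / 2)) + ∫ t in (0 : ℝ)..π, HpiIntegrand t

end MagnusHilbert

end

noncomputable section

namespace MagnusHilbert

/-! Put s = p sin t and c = p cos t. After cancelling 2 s sin t, the integrand is p² sin t times a
quotient of entire functions of −s² and c² (`HH_eq`), with denominator (sin s / s)(1 − cos s cosh c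
+ (sin s / s) c sinh c). For 0 ≤ s ≤ π the second factor is positive unless s = c = 0 (`le_kerDen`,
`kerDen_pos`), and sin s / s vanishes only at s = π. So for 0 < p ≤ π the only singularity is at p =
π, t = π/2.

Near p = π the singular part is 2 / (1 − (s/π)²), whose integral is elementary and equals 2π²/√(π² −
p²). What remains is (`regHH` − 2) / (1 − (s/π)²), where `regHH` is C¹ on a compact convex region
and equals 2 at (π, π). A Lipschitz bound makes the quotient bounded uniformly in p, and dominated
convergence gives the constant `Hpi`. The three forms of the main term differ by a differentiable
increment divided by √(π − p), which tends to 0.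

Near p = 0 numerator and denominator both carry a factor p². With it removed they have expansions in
p² whose remainders are continuous in (p, sin² t), hence bounded on [0,1]². Integrating the
expansion and adding that of the logarithm gives (a). The estimate (c) follows from (a) and (b)
because H(p) / (p√((π + p)/(π − p))) tends to 1 at both ends.

For p = π everything depends on y = sin² t. Divided differences at y = 1 cancel the pole exactly and
give a smooth formula (`HpiIntegrand_eq`). Its rational part is enclosed by Taylor models in u = 1 −
2y = cos 2t with rational arithmetic, compared with an explicit polynomial, and that polynomial is
integrated exactly. -/

theorem hasSum_of_eq {f g : ℕ → ℝ} {c : ℝ} (h : ∀ k, f k = g k) (hg : HasSum g c) :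
    HasSum f c := by
  rwa [show f = g from funext h]

/-! ### Entire functions with factorially bounded coefficients -/

/-- The sum of the power series with coefficients `a`. -/
def powSum (a : ℕ → ℝ) (v : ℝ) : ℝ := ∑' k, a k * v ^ k

/-- Coefficient sequences dominated by those of the exponential function. -/
def ExpDominated (a : ℕ → ℝ) : Prop := ∀ k, |a k| ≤ 1 / (k.factorial : ℝ)

theorem ExpDominated.summable_abs {a : ℕ → ℝ} (ha : ExpDominated a) (v : ℝ) :
    Summable fun k => |a k * v ^ k| := by
  refine Summable.of_nonneg_of_le (fun _ => abs_nonneg _) (fun k => ?_)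
    (Real.summable_pow_div_factorial |v|)
  rw [abs_mul, abs_pow, div_eq_mul_one_div, mul_comm]
  exact mul_le_mul_of_nonneg_left (ha k) (by positivity)

theorem ExpDominated.hasSum {a : ℕ → ℝ} (ha : ExpDominated a) (v : ℝ) :
    HasSum (fun k => a k * v ^ k) (powSum a v) :=
  (ha.summable_abs v).of_abs.hasSum

/-- Closure under shifts puts Taylor remainders, divided by the power of v, in the same class, so
they are entire too. -/
theorem ExpDominated.shift {a : ℕ → ℝ} (ha : ExpDominated a) (n : ℕ) :
    ExpDominated fun k => a (k + n) := by
  intro k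
  refine (ha (k + n)).trans ?_
  have : (k.factorial : ℝ) ≤ ((k + n).factorial : ℝ) := by
    exact_mod_cast Nat.factorial_le (Nat.le_add_right _ _)
  gcongr

theorem ExpDominated.powSum_eq {a : ℕ → ℝ} (ha : ExpDominated a) (n : ℕ) (v : ℝ) :
    powSum a v = ∑ k ∈ Finset.range n, a k * v ^ k + v ^ n * powSum (fun k => a (k + n)) v := by
  rw [powSum, ← (ha.summable_abs v).of_abs.sum_add_tsum_nat_add n, powSum, ← tsum_mul_left]
  congr 1
  refine tsum_congr fun k => ?_
  ring

theorem ExpDominated.analyticAt {a : ℕ → ℝ} (ha : ExpDominated a) (v : ℝ) :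
    AnalyticAt ℝ (powSum a) v := by
  set q := FormalMultilinearSeries.ofScalars ℝ a
  have hrad : q.radius = ⊤ := by
    refine q.radius_eq_top_of_summable_norm fun r => ?_
    refine (ha.summable_abs r).congr fun k => ?_
    rw [FormalMultilinearSeries.ofScalars_norm, abs_mul, Real.norm_eq_abs]
    congr 1
    exact abs_of_nonneg (by positivity)
  have hq := q.hasFPowerSeriesOnBall (by rw [hrad]; exact ENNReal.zero_lt_top)
  have hsum : q.sum = powSum a := by
    funext x
    have := FormalMultilinearSeries.ofScalars_sum_eq (E := ℝ) a x
    simpa [FormalMultilinearSeries.ofScalarsSum, powSum, q] using this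
  rw [hsum] at hq
  exact hq.analyticAt_of_mem (by rw [hrad]; simp)

/-- At the base point the power series is shifted by one; elsewhere the slope is an honest quotient.
Every division by 1 − y below is a `dslope`, so this is the source of all smooth extensions. -/
theorem analyticAt_dslope {f : ℝ → ℝ} (hf : ∀ x, AnalyticAt ℝ f x) (a x : ℝ) :
    AnalyticAt ℝ (dslope f a) x := by
  rcases eq_or_ne x a with rfl | hx
  · obtain ⟨q, hq⟩ := hf x
    exact hq.has_fpower_series_dslope_fslope.analyticAt
  · have h : AnalyticAt ℝ (fun y => (y - a)⁻¹ * (f y - f a)) x :=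
      ((analyticAt_id.sub analyticAt_const).inv (by simpa [sub_eq_zero] using hx)).mul
        ((hf x).sub analyticAt_const)
    refine h.congr ?_
    filter_upwards [isOpen_ne.mem_nhds hx] with y hy
    rw [dslope_of_ne _ hy, slope_def_field, div_eq_inv_mul]

/-- `cosCoeff k = 1 / (2k)!`. -/
def cosCoeff (k : ℕ) : ℝ := 1 / ((2 * k).factorial : ℝ)
/-- `sinCoeff k = 1 / (2k+1)!`. -/
def sinCoeff (k : ℕ) : ℝ := 1 / ((2 * k + 1).factorial : ℝ)
/-- The coefficients of `(sin s - s cos s) / s ^ 3` as a series in `-s ^ 2`. -/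
def besCoeff (k : ℕ) : ℝ := 2 * (k + 1) / ((2 * k + 3).factorial : ℝ)

theorem expDominated_cosCoeff : ExpDominated cosCoeff := by
  intro k
  rw [cosCoeff, abs_of_nonneg (by positivity)]
  have : (k.factorial : ℝ) ≤ ((2 * k).factorial : ℝ) := by
    exact_mod_cast Nat.factorial_le (by omega)
  gcongr

theorem expDominated_sinCoeff : ExpDominated sinCoeff := by
  intro k
  rw [sinCoeff, abs_of_nonneg (by positivity)]
  have : (k.factorial : ℝ) ≤ ((2 * k + 1).factorial : ℝ) := by
    exact_mod_cast Nat.factorial_le (by omega)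
  gcongr

/-- Coefficient form of v · `bs` v = `cs` v − `ss` v; it also bounds `besCoeff` by the cosine
coefficients. -/
theorem besCoeff_eq (k : ℕ) : besCoeff k = cosCoeff (k + 1) - sinCoeff (k + 1) := by
  have h : ((2 * k + 3).factorial : ℝ) = (2 * k + 3) * ((2 * k + 2).factorial : ℝ) := by
    rw [Nat.factorial_succ]; push_cast; ring
  rw [besCoeff, cosCoeff, sinCoeff, show 2 * (k + 1) + 1 = 2 * k + 3 by ring,
    show 2 * (k + 1) = 2 * k + 2 by ring, h]
  have : ((2 * k + 2).factorial : ℝ) ≠ 0 := by positivity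
  have : (2 * k + 3 : ℝ) ≠ 0 := by positivity
  field_simp
  ring

theorem expDominated_besCoeff : ExpDominated besCoeff := by
  intro k
  have h0 : 0 ≤ besCoeff k := by rw [besCoeff]; positivity
  have h1 := expDominated_cosCoeff.shift 1 k
  have h2 : 0 ≤ sinCoeff (k + 1) := by rw [sinCoeff]; positivity
  rw [abs_of_nonneg h0, besCoeff_eq]
  linarith [le_abs_self (cosCoeff (k + 1))]

/-- The entire function with `cs (x ^ 2) = cosh x` and `cs (-x ^ 2) = cos x`. -/
def cs : ℝ → ℝ := powSum cosCoeff
/-- The entire function with `x * ss (x ^ 2) = sinh x` and `x * ss (-x ^ 2) = sin x`. -/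
def ss : ℝ → ℝ := powSum sinCoeff
/-- The entire function with `x ^ 3 * bs (-x ^ 2) = sin x - x * cos x`. -/
def bs : ℝ → ℝ := powSum besCoeff

theorem analyticAt_cs (v : ℝ) : AnalyticAt ℝ cs v := expDominated_cosCoeff.analyticAt v
theorem analyticAt_ss (v : ℝ) : AnalyticAt ℝ ss v := expDominated_sinCoeff.analyticAt v
theorem analyticAt_bs (v : ℝ) : AnalyticAt ℝ bs v := expDominated_besCoeff.analyticAt v

theorem cs_sq (x : ℝ) : cs (x ^ 2) = cosh x := by
  refine (expDominated_cosCoeff.hasSum _).unique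
    (hasSum_of_eq (fun k => ?_) (Real.hasSum_cosh x))
  rw [cosCoeff, ← pow_mul]; ring

theorem cs_neg_sq (x : ℝ) : cs (-x ^ 2) = cos x := by
  refine (expDominated_cosCoeff.hasSum _).unique
    (hasSum_of_eq (fun k => ?_) (Real.hasSum_cos x))
  rw [cosCoeff, neg_pow, ← pow_mul]; ring

theorem mul_ss_sq (x : ℝ) : x * ss (x ^ 2) = sinh x := by
  refine ((expDominated_sinCoeff.hasSum (x ^ 2)).mul_left x).unique
    (hasSum_of_eq (fun k => ?_) (Real.hasSum_sinh x))
  rw [sinCoeff, ← pow_mul]; ring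

theorem mul_ss_neg_sq (x : ℝ) : x * ss (-x ^ 2) = sin x := by
  refine ((expDominated_sinCoeff.hasSum (-x ^ 2)).mul_left x).unique
    (hasSum_of_eq (fun k => ?_) (Real.hasSum_sin x))
  rw [sinCoeff, neg_pow, ← pow_mul]; ring

theorem mul_bs (v : ℝ) : v * bs v = cs v - ss v := by
  have hc := expDominated_cosCoeff.powSum_eq 1 v
  have hs := expDominated_sinCoeff.powSum_eq 1 v
  have h : bs v = powSum (fun k => cosCoeff (k + 1)) v - powSum (fun k => sinCoeff (k + 1)) v := by
    refine (expDominated_besCoeff.hasSum v).unique (hasSum_of_eq (fun k => ?_)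
      (((expDominated_cosCoeff.shift 1).hasSum v).sub ((expDominated_sinCoeff.shift 1).hasSum v)))
    rw [besCoeff_eq]; ring
  simp only [Finset.sum_range_one, pow_zero, mul_one, pow_one] at hc hs
  rw [cs, ss, hc, hs, h]
  simp [cosCoeff, sinCoeff]
  ring

theorem pow_mul_bs (x : ℝ) : x ^ 3 * bs (-x ^ 2) = sin x - x * cos x := by
  have h := mul_bs (-x ^ 2)
  rw [cs_neg_sq] at h
  rw [← mul_ss_neg_sq x]
  linear_combination (-x) * h

theorem cs_zero : cs 0 = 1 := by simpa using cs_sq 0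

theorem ss_zero : ss 0 = 1 := by
  have := expDominated_sinCoeff.powSum_eq 1 0
  simpa [ss, sinCoeff] using this

/-! ### Reduced form of the integrand and positivity of its denominator -/

/-- The numerator of `HH` with trivial zeros removed, at `a = -(p sin t)²`, `b = (p cos t)²`. -/
def kerNum (a b : ℝ) : ℝ := bs a * (cs b - cs a)

/-- The nontrivial factor of the denominator of `HH`, at `a = -(p sin t)²`, `b = (p cos t)²`. -/
def kerDen (a b : ℝ) : ℝ := 1 - cs a * cs b + ss a * (b * ss b)

/-- Expanding the sines of −t + s and t + s and writing exp(±c) as cosh c ± sinh c, the only term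
without a visible factor sin t is cos t sin s, which equals c sin t (sin s / s). The common factor 2
s sin t then cancels. -/
theorem HH_eq {p t : ℝ} (hp : p ≠ 0) (ht : sin t ≠ 0) :
    HH p t = p ^ 2 * sin t * kerNum (-(p * sin t) ^ 2) ((p * cos t) ^ 2) /
      (ss (-(p * sin t) ^ 2) * kerDen (-(p * sin t) ^ 2) ((p * cos t) ^ 2)) := by
  set s := p * sin t with hs
  set c := p * cos t with hc
  have hs0 : s ≠ 0 := mul_ne_zero hp ht
  have h1 : sin s - s * cos s = s ^ 3 * bs (-s ^ 2) := (pow_mul_bs s).symm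
  have h2 : exp c + exp (-c) - 2 * cos s = 2 * (cs (c ^ 2) - cs (-s ^ 2)) := by
    rw [cs_sq, cs_neg_sq, cosh_eq]; ring
  have h3 : 2 * sin t + exp c * sin (-t + s) - exp (-c) * sin (t + s)
      = 2 * sin t * kerDen (-s ^ 2) (c ^ 2) := by
    have e1 : c ^ 2 * ss (c ^ 2) = c * sinh c := by rw [← mul_ss_sq]; ring
    have e2 : cos t * sin s = c * sin t * ss (-s ^ 2) := by rw [← mul_ss_neg_sq, hs, hc]; ring
    rw [kerDen, e1, cs_sq, cs_neg_sq, sin_add, sin_add, sin_neg, cos_neg]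
    have e3 : exp c = cosh c + sinh c := (cosh_add_sinh c).symm
    have e4 : exp (-c) = cosh c - sinh c := (cosh_sub_sinh c).symm
    rw [e3, e4]
    linear_combination 2 * sinh c * e2
  have h4 : sin s = s * ss (-s ^ 2) := (mul_ss_neg_sq s).symm
  rw [HH, ← hs, ← hc, h1, h2, h3, h4, kerNum]
  have h5 : s ^ 3 * bs (-s ^ 2) * (2 * (cs (c ^ 2) - cs (-s ^ 2)))
      = 2 * s * sin t * (p ^ 2 * sin t * (bs (-s ^ 2) * (cs (c ^ 2) - cs (-s ^ 2)))) := by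
    rw [hs]; ring
  have h6 : s * ss (-s ^ 2) * (2 * sin t * kerDen (-s ^ 2) (c ^ 2))
      = 2 * s * sin t * (ss (-s ^ 2) * kerDen (-s ^ 2) (c ^ 2)) := by ring
  rw [h5, h6, mul_div_mul_left _ _ (by positivity)]

theorem mul_cos_le_sin {s : ℝ} (h0 : 0 ≤ s) (h1 : s ≤ π) : s * cos s ≤ sin s := by
  rcases lt_or_ge s (π / 2) with h | h
  · have hc : 0 < cos s := cos_pos_of_mem_Ioo ⟨by linarith [pi_pos], h⟩
    have := le_tan h0 h
    rwa [tan_eq_sin_div_cos, le_div_iff₀ hc] at this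
  · have hc : cos s ≤ 0 := cos_nonpos_of_pi_div_two_le_of_le h (by linarith [pi_pos])
    exact (mul_nonpos_of_nonneg_of_nonpos h0 hc).trans (sin_nonneg_of_nonneg_of_le_pi h0 h1)

theorem cos_le_ss {s : ℝ} (h0 : 0 ≤ s) (h1 : s ≤ π) : cos s ≤ ss (-s ^ 2) := by
  rcases h0.eq_or_lt with rfl | h
  · simp [ss_zero]
  · have := mul_cos_le_sin h0 h1
    rw [← mul_ss_neg_sq] at this
    exact le_of_mul_le_mul_left this h

theorem ss_pos {s : ℝ} (h0 : 0 ≤ s) (h1 : s < π) : 0 < ss (-s ^ 2) := by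
  rcases h0.eq_or_lt with rfl | h
  · simp [ss_zero]
  · have := sin_pos_of_pos_of_lt_pi h h1
    rw [← mul_ss_neg_sq] at this
    exact pos_of_mul_pos_right this h0

theorem ss_neg_pi_sq : ss (-π ^ 2) = 0 := by
  have := mul_ss_neg_sq π
  rw [sin_pi] at this
  exact (mul_eq_zero.mp this).resolve_left pi_ne_zero

theorem ss_nonneg {s : ℝ} (h0 : 0 ≤ s) (h1 : s ≤ π) : 0 ≤ ss (-s ^ 2) := by
  rcases h1.eq_or_lt with rfl | h
  · rw [ss_neg_pi_sq]
  · exact (ss_pos h0 h).le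

theorem sinh_le_mul_cosh {x : ℝ} (hx0 : 0 ≤ x) : sinh x ≤ x * cosh x := by
  have hmono : MonotoneOn (fun y => y * cosh y - sinh y) (Ici 0) := by
    refine monotoneOn_of_deriv_nonneg (convex_Ici 0) (by fun_prop) (by fun_prop) fun y hy => ?_
    rw [interior_Ici, mem_Ioi] at hy
    have hd : HasDerivAt (fun y => y * cosh y - sinh y) (1 * cosh y + y * sinh y - cosh y) y :=
      ((hasDerivAt_id' y).mul (hasDerivAt_cosh y)).sub (hasDerivAt_sinh y)
    rw [hd.deriv]
    have := mul_nonneg hy.le (sinh_nonneg_iff.mpr hy.le)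
    linarith
  have := hmono (mem_Ici.mpr le_rfl) (mem_Ici.mpr hx0) hx0
  simp only [zero_mul, sinh_zero, sub_zero] at this
  linarith

/-- With x = c/2 the half-angle formulas reduce this to sinh x ≤ x cosh x, multiplied by sinh x. -/
theorem two_mul_cosh_sub_one_le (c : ℝ) : 2 * (cosh c - 1) ≤ c * sinh c := by
  wlog h : 0 ≤ c generalizing c
  · have := this (-c) (by linarith)
    simpa using this
  set x := c / 2 with hx
  have e1 : cosh c = 1 + 2 * sinh x ^ 2 := by
    rw [show c = 2 * x by rw [hx]; ring, cosh_two_mul, cosh_sq]; ring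
  have e2 : sinh c = 2 * sinh x * cosh x := by
    rw [show c = 2 * x by rw [hx]; ring, sinh_two_mul]
  have hx0 : 0 ≤ x := by positivity
  have h1 := sinh_le_mul_cosh hx0
  have h2 := sinh_nonneg_iff.mpr hx0
  rw [e1, e2, show c = 2 * x by rw [hx]; ring]
  nlinarith [mul_le_mul_of_nonneg_left h1 h2]

/-- Let σ = sin s / s ≥ 0. Replacing c sinh c by 2(cosh c − 1) leaves (1 − cos s) + (2σ − cos
s)(cosh c − 1), and cos s ≤ σ. Both terms of the resulting bound are nonnegative. -/
theorem le_kerDen {s : ℝ} (c : ℝ) (h0 : 0 ≤ s) (h1 : s ≤ π) :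
    (1 - cos s) + ss (-s ^ 2) * (cosh c - 1) ≤ kerDen (-s ^ 2) (c ^ 2) := by
  have e1 : c ^ 2 * ss (c ^ 2) = c * sinh c := by rw [← mul_ss_sq]; ring
  rw [kerDen, e1, cs_sq, cs_neg_sq]
  have ha := mul_le_mul_of_nonneg_left (two_mul_cosh_sub_one_le c) (ss_nonneg h0 h1)
  have hb := mul_le_mul_of_nonneg_right (cos_le_ss h0 h1) (sub_nonneg.mpr (one_le_cosh c))
  nlinarith

theorem kerDen_pos {s c : ℝ} (h0 : 0 ≤ s) (h1 : s ≤ π) (h : s ≠ 0 ∨ c ≠ 0) :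
    0 < kerDen (-s ^ 2) (c ^ 2) := by
  refine lt_of_lt_of_le ?_ (le_kerDen c h0 h1)
  have hb := mul_nonneg (ss_nonneg h0 h1) (sub_nonneg.mpr (one_le_cosh c))
  rcases h0.eq_or_lt with rfl | hs
  · have hc : c ≠ 0 := by simpa using h
    have := one_lt_cosh.mpr hc
    simp only [cos_zero, ne_eq, OfNat.ofNat_ne_zero, not_false_eq_true, zero_pow, neg_zero,
      ss_zero]
    linarith
  · have : cos s < 1 := by
      have := cos_lt_cos_of_nonneg_of_le_pi le_rfl h1 hs
      rwa [cos_zero] at this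
    linarith

/-! ### Extraction of the singularity at p = π, t = π/2 -/

/-- The quotient of `ss (-(π² y))` by `1 - y`. -/
def sincQuot (y : ℝ) : ℝ := -dslope (fun y => ss (-(π ^ 2 * y))) 1 y

theorem analyticAt_scaled {f : ℝ → ℝ} (hf : ∀ v, AnalyticAt ℝ f v) (r y : ℝ) :
    AnalyticAt ℝ (fun y => f (r * y)) y :=
  (hf (r * y)).comp_of_eq (analyticAt_const.mul analyticAt_id) rfl

theorem analyticAt_sincQuot (y : ℝ) : AnalyticAt ℝ sincQuot y := by
  refine (analyticAt_dslope (fun x => ?_) 1 y).neg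
  simpa using analyticAt_scaled analyticAt_ss (-π ^ 2) x

theorem one_sub_mul_sincQuot (y : ℝ) : (1 - y) * sincQuot y = ss (-(π ^ 2 * y)) := by
  have := sub_smul_dslope (fun y => ss (-(π ^ 2 * y))) 1 y
  simp only [smul_eq_mul, mul_one, ss_neg_pi_sq, sub_zero] at this
  rw [sincQuot, ← this]; ring

/-- Differentiating s · `ss` (−s²) = sin s at π, where `ss` vanishes, determines the derivative of
`ss` at −π². -/
theorem sincQuot_one : sincQuot 1 = 1 / 2 := by
  have hd : HasDerivAt ss (deriv ss (-π ^ 2)) (-π ^ 2) :=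
    (analyticAt_ss _).differentiableAt.hasDerivAt
  have h1 : HasDerivAt (fun s : ℝ => -s ^ 2) (-(2 * π)) π := by
    simpa using (hasDerivAt_pow 2 π).fun_neg
  have h2 : HasDerivAt (fun s : ℝ => s * ss (-s ^ 2))
      (1 * ss (-π ^ 2) + π * (deriv ss (-π ^ 2) * -(2 * π))) π :=
    (hasDerivAt_id' π).mul (hd.comp π h1)
  have h3 := h2.unique ((funext mul_ss_neg_sq : (fun s : ℝ => s * ss (-s ^ 2)) = sin) ▸
    hasDerivAt_sin π)
  rw [ss_neg_pi_sq, cos_pi] at h3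
  have h4 : HasDerivAt (fun y : ℝ => -(π ^ 2 * y)) (-(π ^ 2)) 1 := by
    simpa using ((hasDerivAt_id' (1 : ℝ)).const_mul (π ^ 2)).fun_neg
  have h5 : HasDerivAt (fun y : ℝ => ss (-(π ^ 2 * y))) (deriv ss (-π ^ 2) * -(π ^ 2)) 1 :=
    HasDerivAt.comp (1 : ℝ) (by rw [mul_one]; exact hd) h4
  rw [sincQuot, dslope_same, h5.deriv]
  linear_combination (-1 / 2) * h3

theorem sincQuot_pos {y : ℝ} (h0 : 0 ≤ y) (h1 : y ≤ 1) : 0 < sincQuot y := by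
  rcases h1.eq_or_lt with rfl | h
  · rw [sincQuot_one]; norm_num
  · have h2 := one_sub_mul_sincQuot y
    have h3 : √y < 1 := by rw [sqrt_lt' one_pos]; simpa using h
    have h4 : 0 < ss (-(π * √y) ^ 2) :=
      ss_pos (by positivity) (by nlinarith [pi_pos])
    rw [mul_pow, sq_sqrt h0, ← h2] at h4
    exact pos_of_mul_pos_right h4 (by linarith)

theorem integrable_HH {p : ℝ} (hp : p ∈ Ioo (0 : ℝ) π) : IntervalIntegrable (HH p) volume 0 π := by
  have hcs : Continuous cs := continuous_iff_continuousAt.mpr fun v => (analyticAt_cs v).continuousAt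
  have hss : Continuous ss := continuous_iff_continuousAt.mpr fun v => (analyticAt_ss v).continuousAt
  have hbs : Continuous bs := continuous_iff_continuousAt.mpr fun v => (analyticAt_bs v).continuousAt
  have hc : ContinuousOn (fun t => p ^ 2 * sin t * kerNum (-(p * sin t) ^ 2) ((p * cos t) ^ 2) /
      (ss (-(p * sin t) ^ 2) * kerDen (-(p * sin t) ^ 2) ((p * cos t) ^ 2))) (uIcc 0 π) := by
    refine ContinuousOn.div ?_ ?_ fun t ht => ?_
    · unfold kerNum; fun_prop
    · unfold kerDen; fun_prop
    · rw [uIcc_of_le pi_pos.le] at ht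
      have h0 : 0 ≤ sin t := sin_nonneg_of_mem_Icc ht
      have h1 : p * sin t < π := by nlinarith [sin_le_one t, hp.1, hp.2]
      have h2 : 0 ≤ p * sin t := mul_nonneg hp.1.le h0
      refine mul_ne_zero (ss_pos h2 h1).ne' (kerDen_pos h2 h1.le ?_).ne'
      by_contra! h
      have hs : sin t = 0 := (mul_eq_zero.mp h.1).resolve_left hp.1.ne'
      have hc : cos t = 0 := (mul_eq_zero.mp h.2).resolve_left hp.1.ne'
      have := sin_sq_add_cos_sq t
      rw [hs, hc] at this
      norm_num at this
  refine hc.intervalIntegrable.congr_uIoo fun t ht => ?_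
  rw [uIoo_of_le pi_pos.le] at ht
  exact (HH_eq hp.1.ne' (sin_pos_of_mem_Ioo ht).ne').symm

@[fun_prop]
theorem contDiff_cs {n : WithTop ℕ∞} : ContDiff ℝ n cs :=
  contDiff_iff_contDiffAt.mpr fun v => (analyticAt_cs v).contDiffAt

@[fun_prop]
theorem contDiff_ss {n : WithTop ℕ∞} : ContDiff ℝ n ss :=
  contDiff_iff_contDiffAt.mpr fun v => (analyticAt_ss v).contDiffAt

@[fun_prop]
theorem contDiff_bs {n : WithTop ℕ∞} : ContDiff ℝ n bs :=
  contDiff_iff_contDiffAt.mpr fun v => (analyticAt_bs v).contDiffAt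

@[fun_prop]
theorem contDiff_sincQuot {n : WithTop ℕ∞} : ContDiff ℝ n sincQuot :=
  contDiff_iff_contDiffAt.mpr fun v => (analyticAt_sincQuot v).contDiffAt

/-- `HH p t * (1 - s² / π²)` as a function of `p` and `s = p * sin t`. -/
def regHH (x : ℝ × ℝ) : ℝ :=
  x.1 * x.2 * kerNum (-x.2 ^ 2) (x.1 ^ 2 - x.2 ^ 2) /
    (sincQuot (x.2 ^ 2 / π ^ 2) * kerDen (-x.2 ^ 2) (x.1 ^ 2 - x.2 ^ 2))

/-- The region of the pairs `(p, p * sin t)` with `π / 2 ≤ p ≤ π`. -/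
def regDom : Set (ℝ × ℝ) := {x | (π / 2 ≤ x.1 ∧ x.1 ≤ π) ∧ 0 ≤ x.2 ∧ x.2 ≤ x.1}

theorem kerDen_pos_of_le {p s : ℝ} (h0 : 0 ≤ s) (h1 : s ≤ p) (hp : 0 < p) (h2 : p ≤ π) :
    0 < kerDen (-s ^ 2) (p ^ 2 - s ^ 2) := by
  have h3 : 0 ≤ p ^ 2 - s ^ 2 := by nlinarith
  rw [← sq_sqrt h3]
  refine kerDen_pos h0 (h1.trans h2) ?_
  by_contra! h
  have := (sqrt_eq_zero h3).mp h.2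
  rw [h.1] at this
  nlinarith

theorem sincQuot_sq_pos {s : ℝ} (h0 : 0 ≤ s) (h1 : s ≤ π) : 0 < sincQuot (s ^ 2 / π ^ 2) := by
  have := pi_pos
  refine sincQuot_pos (by positivity) ?_
  rw [div_le_one (by positivity)]
  gcongr

theorem contDiffAt_regHH {x : ℝ × ℝ} (hx : x ∈ regDom) : ContDiffAt ℝ 1 regHH x := by
  obtain ⟨⟨h1, h2⟩, h3, h4⟩ := hx
  have h5 : 0 < x.1 := by linarith [pi_pos]
  have h6 := (mul_pos (sincQuot_sq_pos h3 (h4.trans h2)) (kerDen_pos_of_le h3 h4 h5 h2)).ne'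
  unfold regHH
  refine ContDiffAt.div ?_ ?_ h6
  · unfold kerNum; fun_prop
  · unfold kerDen; fun_prop

theorem regHH_pi : regHH (π, π) = 2 := by
  have h1 := pow_mul_bs π
  rw [sin_pi, cos_pi] at h1
  have h2 : cs (-π ^ 2) = -1 := by rw [cs_neg_sq, cos_pi]
  simp only [regHH, kerNum, kerDen, sub_self, cs_zero, ss_neg_pi_sq, h2]
  rw [div_self (by positivity), sincQuot_one]
  have h3 : π * (π ^ 2 * bs (-π ^ 2) - 1) = 0 := by linear_combination h1
  have h4 := (mul_eq_zero.mp h3).resolve_left pi_ne_zero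
  linear_combination 2 * h4

/-- A C¹ function is Lipschitz on a compact convex set, and `regHH` takes the value 2 at the corner
(π, π). -/
theorem exists_abs_regHH_sub_le :
    ∃ K : ℝ, 0 ≤ K ∧ ∀ x ∈ regDom, |regHH x - 2| ≤ K * (π - x.2) := by
  have hpi := pi_pos
  have hconv : Convex ℝ regDom := by
    refine ((convex_halfSpace_ge (f := fun x : ℝ × ℝ => x.1) ⟨fun _ _ => rfl, fun _ _ => rfl⟩ _).inter
      (convex_halfSpace_le (f := fun x : ℝ × ℝ => x.1) ⟨fun _ _ => rfl, fun _ _ => rfl⟩ _)).inter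
      ((convex_halfSpace_ge (f := fun x : ℝ × ℝ => x.2) ⟨fun _ _ => rfl, fun _ _ => rfl⟩ _).inter ?_)
    have : {x : ℝ × ℝ | x.2 ≤ x.1} = {x : ℝ × ℝ | x.2 - x.1 ≤ 0} := by
      ext x; simp
    change Convex ℝ {x : ℝ × ℝ | x.2 ≤ x.1}
    rw [this]
    exact convex_halfSpace_le (f := fun x : ℝ × ℝ => x.2 - x.1)
      ⟨fun x y => by simp only [Prod.fst_add, Prod.snd_add]; ring,
        fun c x => by simp only [Prod.smul_fst, Prod.smul_snd, smul_eq_mul]; ring⟩ _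
  have hcomp : IsCompact regDom := by
    refine (isCompact_Icc.prod isCompact_Icc : IsCompact (Icc (π / 2) π ×ˢ Icc 0 π)).of_isClosed_subset
      ?_ ?_
    · exact ((isClosed_le continuous_const continuous_fst).inter
        (isClosed_le continuous_fst continuous_const)).inter
        ((isClosed_le continuous_const continuous_snd).inter
        (isClosed_le continuous_snd continuous_fst))
    · rintro x ⟨⟨h1, h2⟩, h3, h4⟩
      exact ⟨⟨h1, h2⟩, h3, h4.trans h2⟩
  have hcd : ContDiffOn ℝ 1 regHH regDom := fun x hx => (contDiffAt_regHH hx).contDiffWithinAt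
  obtain ⟨K, hK⟩ := hcd.exists_lipschitzOnWith one_ne_zero hconv hcomp
  refine ⟨K, K.2, fun x hx => ?_⟩
  have hmem : ((π, π) : ℝ × ℝ) ∈ regDom := ⟨⟨by linarith, le_rfl⟩, hpi.le, le_rfl⟩
  have h := hK.dist_le_mul x hx _ hmem
  rw [regHH_pi, Real.dist_eq] at h
  refine h.trans (mul_le_mul_of_nonneg_left ?_ K.2)
  obtain ⟨⟨h1, h2⟩, h3, h4⟩ := hx
  rw [Prod.dist_eq, Real.dist_eq, Real.dist_eq]
  -- Since s ≤ p ≤ π, both coordinates are within π − s of π.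
  refine max_le ?_ ?_
  · rw [abs_sub_comm, abs_of_nonneg (by linarith)]; linarith
  · rw [abs_sub_comm, abs_of_nonneg (by linarith)]

/-- The zero of `ss` (−s²) at s = π is the factor 1 − (s/π)²; dividing it out of the denominator
leaves exactly `regHH`. -/
theorem HH_sub_eq {p t : ℝ} (hp : 0 < p) (ht : 0 < sin t) (hs : p * sin t < π) :
    HH p t - 2 / (1 - (p * sin t / π) ^ 2) =
      (regHH (p, p * sin t) - 2) / (1 - (p * sin t / π) ^ 2) := by
  have hpi := pi_pos
  set s := p * sin t with hsd
  have h0 : 0 < s := mul_pos hp ht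
  have hw : 0 < 1 - (s / π) ^ 2 := by
    have : s / π < 1 := (div_lt_one hpi).mpr hs
    have : 0 < s / π := by positivity
    nlinarith
  have h1 : ss (-s ^ 2) = (1 - (s / π) ^ 2) * sincQuot (s ^ 2 / π ^ 2) := by
    rw [div_pow, one_sub_mul_sincQuot]
    congr 1
    field_simp
  have h2 : (p * cos t) ^ 2 = p ^ 2 - s ^ 2 := by
    rw [hsd, mul_pow, mul_pow, cos_sq']; ring
  rw [HH_eq hp.ne' ht.ne', ← hsd, h1, h2, regHH, sub_div]
  congr 1
  rw [div_div]
  congr 1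
  · rw [hsd]; ring
  · ring

theorem one_sub_sq_pos {p t : ℝ} (h0 : 0 < p) (hp : p ≤ π) (ht : t ∈ Ioo 0 π)
    (h : p < π ∨ t ≠ π / 2) : 0 < sin t ∧ p * sin t < π := by
  have h1 := sin_pos_of_mem_Ioo ht
  refine ⟨h1, ?_⟩
  rcases h with h | h
  · nlinarith [sin_le_one t]
  · have h2 : sin t < 1 := by
      refine lt_of_le_of_ne (sin_le_one t) fun h3 => h ?_
      have hc : cos t = 0 := by
        have := sin_sq_add_cos_sq t
        rw [h3] at this
        exact pow_eq_zero_iff (two_ne_zero) |>.mp (by linarith)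
      exact injOn_cos (Ioo_subset_Icc_self ht) ⟨by linarith [pi_pos], by linarith [pi_pos]⟩
        (by rw [hc, cos_pi_div_two])
    nlinarith

theorem tendsto_integral_HH_sub :
    Tendsto (fun p => ∫ t in (0 : ℝ)..π, (HH p t - 2 / (1 - (p * sin t / π) ^ 2)))
      (𝓝[<] π) (𝓝 (∫ t in (0 : ℝ)..π, HpiIntegrand t)) := by
  have hpi := pi_pos
  obtain ⟨K, hK0, hK⟩ := exists_abs_regHH_sub_le
  have hev : ∀ᶠ p in 𝓝[<] π, p ∈ Ioo (π / 2) π :=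
    Ioo_mem_nhdsLT (by linarith)
  have hne : ∀ᵐ t : ℝ, t ≠ π / 2 := by simp [ae_iff]
  have hne' : ∀ᵐ t : ℝ, t ≠ π := by simp [ae_iff]
  have hdom : ∀ {p t : ℝ}, p ∈ Icc (π / 2) π → t ∈ Ioo 0 π → (p, p * sin t) ∈ regDom := by
    intro p t hp ht
    have h1 := sin_pos_of_mem_Ioo ht
    have h2 : 0 ≤ p := by linarith [hp.1]
    exact ⟨hp, mul_nonneg h2 h1.le, by nlinarith [sin_le_one t]⟩
  -- The numerator is at most K(π − s) and the denominator at least (π − s)/π, hence the constant K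
  -- π.
  refine intervalIntegral.tendsto_integral_filter_of_dominated_convergence (fun _ => K * π) ?_ ?_
    intervalIntegrable_const ?_
  · refine Eventually.of_forall fun p => Measurable.aestronglyMeasurable ?_
    unfold HH; fun_prop
  · filter_upwards [hev] with p hp
    filter_upwards [hne'] with t ht1 ht
    rw [uIoc_of_le hpi.le] at ht
    have ht' : t ∈ Ioo 0 π := ⟨ht.1, lt_of_le_of_ne ht.2 ht1⟩
    have hp0 : 0 < p := by linarith [hp.1]
    obtain ⟨h1, h2⟩ := one_sub_sq_pos hp0 hp.2.le ht' (Or.inl hp.2)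
    rw [HH_sub_eq hp0 h1 h2, Real.norm_eq_abs, abs_div]
    have h3 := hK _ (hdom ⟨hp.1.le, hp.2.le⟩ ht')
    simp only at h3
    set s := p * sin t
    have hs0 : 0 < s := mul_pos hp0 h1
    -- This is 1 − x ≤ 1 − x² for x = s/π in [0, 1].
    have h4 : (π - s) / π ≤ 1 - (s / π) ^ 2 := by
      have h5 : s / π < 1 := (div_lt_one hpi).mpr h2
      have h6 : 0 < s / π := by positivity
      rw [sub_div, div_self hpi.ne']
      nlinarith
    have h7 : 0 < (π - s) / π := div_pos (by linarith) hpi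
    rw [abs_of_pos (h7.trans_le h4), div_le_iff₀ (h7.trans_le h4)]
    calc _ ≤ K * (π - s) := h3
      _ = K * π * ((π - s) / π) := by field_simp
      _ ≤ _ := by gcongr
  · filter_upwards [hne, hne'] with t ht2 ht1 ht
    rw [uIoc_of_le hpi.le] at ht
    have ht' : t ∈ Ioo 0 π := ⟨ht.1, lt_of_le_of_ne ht.2 ht1⟩
    obtain ⟨h1, h2⟩ := one_sub_sq_pos hpi le_rfl ht' (Or.inr ht2)
    have hlim : HpiIntegrand t = (regHH (π, π * sin t) - 2) / (1 - (π * sin t / π) ^ 2) := by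
      rw [← HH_sub_eq hpi h1 h2, HpiIntegrand, mul_div_cancel_left₀ _ hpi.ne', cos_sq']
    have hcont : ContinuousAt
        (fun p => (regHH (p, p * sin t) - 2) / (1 - (p * sin t / π) ^ 2)) π := by
      have hr : ContinuousAt regHH (π, π * sin t) :=
        (contDiffAt_regHH (hdom ⟨by linarith, le_rfl⟩ ht')).continuousAt
      have hr' : ContinuousAt (fun p : ℝ => regHH (p, p * sin t)) π :=
        ContinuousAt.comp (f := fun p : ℝ => (p, p * sin t)) hr (by fun_prop)
      refine (hr'.sub continuousAt_const).div (by fun_prop) ?_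
      rw [mul_div_cancel_left₀ _ hpi.ne', ← cos_sq']
      refine pow_ne_zero 2 fun hc => ht2 ?_
      exact injOn_cos (Ioo_subset_Icc_self ht') ⟨by linarith, by linarith⟩
        (by rw [hc, cos_pi_div_two])
    rw [hlim]
    refine (hcont.tendsto.mono_left nhdsWithin_le_nhds).congr' ?_
    filter_upwards [hev] with p hp
    have hp0 : 0 < p := by linarith [hp.1]
    obtain ⟨h1, h2⟩ := one_sub_sq_pos hp0 hp.2.le ht' (Or.inl hp.2)
    exact (HH_sub_eq hp0 h1 h2).symm

/-! ### The explicit singular integral and the three forms of (b) -/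

theorem integral_two_div_one_sub_sq {p : ℝ} (hp : p ∈ Ioo (0 : ℝ) π) :
    IntervalIntegrable (fun t => 2 / (1 - (p * sin t / π) ^ 2)) volume 0 π ∧
      ∫ t in (0 : ℝ)..π, 2 / (1 - (p * sin t / π) ^ 2) = 2 * π ^ 2 / √(π ^ 2 - p ^ 2) := by
  have hpi := pi_pos
  obtain ⟨hp0, hp1⟩ := hp
  have hd : 0 < π ^ 2 - p ^ 2 := by nlinarith
  set a := √(π ^ 2 - p ^ 2) / π with ha
  have ha0 : 0 < a := div_pos (sqrt_pos.mpr hd) hpi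
  have ha2 : a ^ 2 = 1 - p ^ 2 / π ^ 2 := by
    rw [ha, div_pow, sq_sqrt hd.le]; field_simp
  have hden : ∀ t, 1 - (p * sin t / π) ^ 2 = cos t ^ 2 + a ^ 2 * sin t ^ 2 := by
    intro t
    rw [ha2, cos_sq']; ring
  have hcs : ∀ t, cos t ≠ 0 ∨ sin t ≠ 0 := by
    intro t
    by_contra! h
    have := sin_sq_add_cos_sq t
    rw [h.1, h.2] at this
    norm_num at this
  have hpos : ∀ t, 0 < cos t ^ 2 + a ^ 2 * sin t ^ 2 := by
    intro t
    rcases hcs t with h | h <;> positivity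
  have hpos1 : ∀ t, 0 < cos t ^ 2 + a * sin t ^ 2 := by
    intro t
    rcases hcs t with h | h <;> positivity
  have hcont : Continuous fun t => 2 / (1 - (p * sin t / π) ^ 2) := by
    refine Continuous.div (by fun_prop) (by fun_prop) fun t => ?_
    rw [hden]; exact (hpos t).ne'
  refine ⟨hcont.intervalIntegrable _ _, ?_⟩
  -- Formally the antiderivative is (2/a) arctan(a tan t). The subtraction formula for the
  -- arctangent turns it into this branch, which is smooth across t = π/2.
  have hderiv : ∀ t, HasDerivAt
      (fun t => 2 / a * (t + arctan ((a - 1) * sin t * cos t / (cos t ^ 2 + a * sin t ^ 2))))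
      (2 / (1 - (p * sin t / π) ^ 2)) t := by
    intro t
    have hn : HasDerivAt (fun t => (a - 1) * sin t * cos t)
        ((a - 1) * cos t * cos t + (a - 1) * sin t * -sin t) t :=
      ((hasDerivAt_sin t).const_mul (a - 1)).mul (hasDerivAt_cos t)
    have hd' : HasDerivAt (fun t => cos t ^ 2 + a * sin t ^ 2)
        (2 * cos t * -sin t + a * (2 * sin t * cos t)) t := by
      simpa using ((hasDerivAt_cos t).fun_pow 2).fun_add (((hasDerivAt_sin t).fun_pow 2).const_mul a)
    have h := ((hasDerivAt_id' t).fun_add (hn.fun_div hd' (hpos1 t).ne').arctan).const_mul (2 / a)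
    refine h.congr_deriv ?_
    rw [hden]
    have e1 := (hpos t).ne'
    have e2 := (hpos1 t).ne'
    have e3 : 1 + ((a - 1) * sin t * cos t / (cos t ^ 2 + a * sin t ^ 2)) ^ 2
        = (cos t ^ 2 + a ^ 2 * sin t ^ 2) / (cos t ^ 2 + a * sin t ^ 2) ^ 2 := by
      field_simp
      linear_combination (cos t ^ 2 + a ^ 2 * sin t ^ 2) * (sin_sq_add_cos_sq t)
    have e4 : ((a - 1) * cos t * cos t + (a - 1) * sin t * -sin t) * (cos t ^ 2 + a * sin t ^ 2) -
        (a - 1) * sin t * cos t * (2 * cos t * -sin t + a * (2 * sin t * cos t))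
        = a - (cos t ^ 2 + a ^ 2 * sin t ^ 2) := by
      linear_combination ((a - 1) * (cos t ^ 2 - a * sin t ^ 2) + a) * (sin_sq_add_cos_sq t)
    rw [e3, e4]
    field_simp
    ring
  rw [intervalIntegral.integral_eq_sub_of_hasDerivAt (fun t _ => hderiv t)
    (hcont.intervalIntegrable _ _)]
  simp only [sin_pi, sin_zero, mul_zero, zero_mul, zero_div, arctan_zero, add_zero, sub_zero]
  rw [ha]
  field_simp

theorem log_arg_pos {p : ℝ} (hp : 0 < p) : 0 < 2 * cosh (p / 2) - 2 / p * sinh (p / 2) := by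
  have h1 := sinh_le_mul_cosh (x := p / 2) (by positivity)
  have h2 : 2 / p * sinh (p / 2) ≤ 2 / p * (p / 2 * cosh (p / 2)) := by gcongr
  have h3 : 2 / p * (p / 2 * cosh (p / 2)) = cosh (p / 2) := by field_simp
  linarith [cosh_pos (p / 2)]

theorem tendsto_H_sub_sqrt :
    Tendsto (fun p => H p - (2 * π ^ 2 / √(π ^ 2 - p ^ 2) + Hpi)) (𝓝[<] π) (𝓝 0) := by
  have hpi := pi_pos
  have hcont : ContinuousAt
      (fun p : ℝ => p - 2 * log (2 * cosh (p / 2) - 2 / p * sinh (p / 2))) π := by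
    refine continuousAt_id.sub (continuousAt_const.mul (ContinuousAt.log ?_ (log_arg_pos hpi).ne'))
    have : ContinuousAt (fun p : ℝ => 2 / p) π := continuousAt_const.div continuousAt_id hpi.ne'
    fun_prop
  have h := ((hcont.tendsto.mono_left nhdsWithin_le_nhds).add tendsto_integral_HH_sub).sub_const Hpi
  rw [show (π - 2 * log (2 * cosh (π / 2) - 2 / π * sinh (π / 2)) +
    ∫ t in (0 : ℝ)..π, HpiIntegrand t) = Hpi from rfl, sub_self] at h
  refine h.congr' ?_
  filter_upwards [Ioo_mem_nhdsLT hpi] with p hp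
  obtain ⟨h1, h2⟩ := integral_two_div_one_sub_sq hp
  rw [intervalIntegral.integral_sub (integrable_HH hp) h1, h2, H]
  ring

/-- The increment is O(a − p), so the quotient is O(√(a − p)). It allows the coefficient of 1/√(π −
p) to be replaced by any differentiable function with the same value at π. -/
theorem tendsto_sub_div_sqrt {h : ℝ → ℝ} {a : ℝ} (hd : DifferentiableAt ℝ h a) :
    Tendsto (fun p => (h p - h a) / √(a - p)) (𝓝[<] a) (𝓝 0) := by
  have h1 : Tendsto (slope h a) (𝓝[<] a) (𝓝 (deriv h a)) :=
    (hasDerivAt_iff_tendsto_slope.mp hd.hasDerivAt).mono_left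
      (nhdsWithin_mono _ fun x hx => ne_of_lt hx)
  have h2 : Tendsto (fun p => -√(a - p)) (𝓝[<] a) (𝓝 0) := by
    have : ContinuousAt (fun p => -√(a - p)) a := by fun_prop
    simpa using this.tendsto.mono_left nhdsWithin_le_nhds
  have h3 := h1.mul h2
  rw [mul_zero] at h3
  refine h3.congr' ?_
  filter_upwards [self_mem_nhdsWithin] with p hp
  have hp' : 0 < a - p := sub_pos.mpr hp
  rw [slope_def_field, div_mul_eq_mul_div, div_eq_div_iff (by linarith) (sqrt_pos.mpr hp').ne']
  linear_combination (-(h p - h a)) * (mul_self_sqrt hp'.le)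

theorem sqrt_two_mul_rpow : √2 * π ^ (3 / 2 : ℝ) = π * √(π + π) := by
  rw [show (3 / 2 : ℝ) = 1 + 1 / 2 by norm_num, rpow_add pi_pos, rpow_one, ← sqrt_eq_rpow,
    ← two_mul, sqrt_mul (by norm_num)]
  ring

theorem mul_sqrt_div_eq {p : ℝ} (hp : p ∈ Ioo (0 : ℝ) π) :
    p * √((π + p) / (π - p)) = p * √(π + p) / √(π - p) := by
  rw [sqrt_div (by linarith [pi_pos, hp.1]), mul_div_assoc]

theorem tendsto_main_sub_mul_sqrt :
    Tendsto (fun p => 2 * π ^ 2 / √(π ^ 2 - p ^ 2) - √2 * π ^ (3 / 2 : ℝ) / √(π - p))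
      (𝓝[<] π) (𝓝 0) := by
  have hpi := pi_pos
  have hd : DifferentiableAt ℝ (fun p => 2 * π ^ 2 / √(π + p)) π := by
    have h1 : DifferentiableAt ℝ (fun p => √(π + p)) π :=
      DifferentiableAt.sqrt (by fun_prop) (by linarith)
    exact (differentiableAt_const _).div h1 (sqrt_pos.mpr (by linarith)).ne'
  refine (tendsto_sub_div_sqrt hd).congr' ?_
  filter_upwards [Ioo_mem_nhdsLT hpi] with p hp
  have h0 : 0 < √(π + π) := sqrt_pos.mpr (by linarith)
  have h1 : 2 * π ^ 2 / √(π + π) = √2 * π ^ (3 / 2 : ℝ) := by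
    rw [sqrt_two_mul_rpow, div_eq_iff h0.ne']
    linear_combination (-π) * mul_self_sqrt (by linarith : 0 ≤ π + π)
  rw [h1, sub_div, div_div, ← sqrt_mul (by linarith [hp.1])]
  congr 4
  ring

theorem tendsto_mul_sqrt_sub :
    Tendsto (fun p => √2 * π ^ (3 / 2 : ℝ) / √(π - p) - p * √((π + p) / (π - p)))
      (𝓝[<] π) (𝓝 0) := by
  have hpi := pi_pos
  have hd : DifferentiableAt ℝ (fun p => -(p * √(π + p))) π := by
    have h1 : DifferentiableAt ℝ (fun p => √(π + p)) π :=
      DifferentiableAt.sqrt (by fun_prop) (by linarith)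
    exact (differentiableAt_id.mul h1).neg
  refine (tendsto_sub_div_sqrt hd).congr' ?_
  filter_upwards [Ioo_mem_nhdsLT hpi] with p hp
  rw [mul_sqrt_div_eq hp, sqrt_two_mul_rpow]
  ring

theorem tendsto_H_sub_rpow :
    Tendsto (fun p => H p - (√2 * π ^ (3 / 2 : ℝ) / √(π - p) + Hpi)) (𝓝[<] π) (𝓝 0) := by
  have := tendsto_H_sub_sqrt.add tendsto_main_sub_mul_sqrt
  rw [add_zero] at this
  refine this.congr fun p => ?_
  ring

theorem tendsto_H_sub_mul_sqrt :
    Tendsto (fun p => H p - (p * √((π + p) / (π - p)) + Hpi)) (𝓝[<] π) (𝓝 0) := by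
  have := tendsto_H_sub_rpow.add tendsto_mul_sqrt_sub
  rw [add_zero] at this
  refine this.congr fun p => ?_
  ring

/-! ### The crude estimate -/

theorem exists_crude_bound
    (h0 : (fun p : ℝ => H p - (p + 1 / 4 * p ^ 2 + 23 / 864 * p ^ 4)) =O[𝓝[>] 0] fun p => p ^ 6) :
    ∃ ε : ℝ → ℝ, Tendsto ε (𝓝[>] 0) (𝓝 0) ∧ Tendsto ε (𝓝[<] π) (𝓝 0) ∧
      ∀ p ∈ Ioo (0 : ℝ) π, H p ≤ (1 + ε p) * (p * √((π + p) / (π - p))) := by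
  have hpi := pi_pos
  have hB : ∀ p ∈ Ioo (0 : ℝ) π, 0 < p * √((π + p) / (π - p)) := fun p hp =>
    mul_pos hp.1 (sqrt_pos.mpr (div_pos (by linarith [hp.1]) (by linarith [hp.2])))
  -- This choice of ε makes the estimate an equality. At 0 the ratio tends to 1 by the expansion; at
  -- π the denominator tends to infinity and absorbs `Hpi`.
  refine ⟨fun p => H p / (p * √((π + p) / (π - p))) - 1, ?_, ?_, fun p hp => ?_⟩
  · have h1 : (fun p : ℝ => H p - (p + 1 / 4 * p ^ 2 + 23 / 864 * p ^ 4)) =o[𝓝[>] 0]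
        fun p => p := by
      refine h0.trans_isLittleO ?_
      have : (fun p : ℝ => p ^ 6) =o[𝓝 0] fun p => p ^ 1 := isLittleO_pow_pow (by norm_num)
      simpa using this.mono nhdsWithin_le_nhds
    have h2 := h1.tendsto_div_nhds_zero
    have h3 : Tendsto (fun p : ℝ => 1 + 1 / 4 * p + 23 / 864 * p ^ 3) (𝓝[>] 0) (𝓝 1) := by
      have : Continuous (fun p : ℝ => 1 + 1 / 4 * p + 23 / 864 * p ^ 3) := by fun_prop
      simpa using (this.tendsto 0).mono_left nhdsWithin_le_nhds
    have h4 : Tendsto (fun p : ℝ => √((π + p) / (π - p))) (𝓝[>] 0) (𝓝 1) := by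
      have : ContinuousAt (fun p : ℝ => √((π + p) / (π - p))) 0 := by
        refine ContinuousAt.sqrt (ContinuousAt.div (by fun_prop) (by fun_prop) (by linarith))
      simpa [hpi.ne'] using this.tendsto.mono_left nhdsWithin_le_nhds
    have h5 := ((h2.add h3).div h4 one_ne_zero).sub_const 1
    simp only [zero_add, div_one, sub_self] at h5
    refine h5.congr' ?_
    filter_upwards [Ioo_mem_nhdsGT hpi] with p hp
    have hp0 := hp.1
    have := hB p hp
    congr 1
    simp only [Pi.div_apply]
    rw [← div_div]
    congr 1
    field_simp
    ring
  · have h1 : Tendsto (fun p : ℝ => p * √((π + p) / (π - p))) (𝓝[<] π) atTop := by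
      have h2 : Tendsto (fun p : ℝ => (√(π - p))⁻¹) (𝓝[<] π) atTop := by
        refine tendsto_inv_nhdsGT_zero.comp (tendsto_nhdsWithin_iff.mpr ⟨?_, ?_⟩)
        · have : ContinuousAt (fun p : ℝ => √(π - p)) π := by fun_prop
          simpa using this.tendsto.mono_left nhdsWithin_le_nhds
        · filter_upwards [self_mem_nhdsWithin] with p hp
          exact sqrt_pos.mpr (sub_pos.mpr hp)
      have h3 : Tendsto (fun p : ℝ => p * √(π + p)) (𝓝[<] π) (𝓝 (π * √(π + π))) := by
        have : ContinuousAt (fun p : ℝ => p * √(π + p)) π := by fun_prop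
        exact this.tendsto.mono_left nhdsWithin_le_nhds
      refine (h3.pos_mul_atTop (by positivity) h2).congr' ?_
      filter_upwards [Ioo_mem_nhdsLT hpi] with p hp
      rw [mul_sqrt_div_eq hp, div_eq_mul_inv]
    have h4 := (tendsto_H_sub_mul_sqrt.add_const Hpi).div_atTop h1
    refine h4.congr' ?_
    filter_upwards [Ioo_mem_nhdsLT hpi] with p hp
    rw [div_sub_one (hB p hp).ne']
    congr 1
    ring
  · rw [add_sub_cancel, div_mul_cancel₀ _ (hB p hp).ne']

/-! ### The expansion at p = 0 -/

/-- The Taylor remainder of order `n` of `powSum a`, divided by `v ^ n`. -/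
def powRem (a : ℕ → ℝ) (n : ℕ) : ℝ → ℝ := powSum fun k => a (k + n)

theorem continuous_powRem {a : ℕ → ℝ} (ha : ExpDominated a) (n : ℕ) : Continuous (powRem a n) :=
  continuous_iff_continuousAt.mpr fun v => ((ha.shift n).analyticAt v).continuousAt

theorem cs_eq_three (v : ℝ) : cs v = 1 + v / 2 + v ^ 2 / 24 + v ^ 3 * powRem cosCoeff 3 v := by
  rw [cs, expDominated_cosCoeff.powSum_eq 3 v, powRem]
  simp [Finset.sum_range_succ, cosCoeff, Nat.factorial]
  ring

theorem ss_eq_two (v : ℝ) : ss v = 1 + v / 6 + v ^ 2 * powRem sinCoeff 2 v := by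
  rw [ss, expDominated_sinCoeff.powSum_eq 2 v, powRem]
  simp [Finset.sum_range_succ, sinCoeff, Nat.factorial]
  ring

theorem ss_eq_three (v : ℝ) : ss v = 1 + v / 6 + v ^ 2 / 120 + v ^ 3 * powRem sinCoeff 3 v := by
  rw [ss, expDominated_sinCoeff.powSum_eq 3 v, powRem]
  simp [Finset.sum_range_succ, sinCoeff, Nat.factorial]
  ring

theorem bs_eq_two (v : ℝ) : bs v = 1 / 3 + v / 30 + v ^ 2 * powRem besCoeff 2 v := by
  rw [bs, expDominated_besCoeff.powSum_eq 2 v, powRem]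
  simp [Finset.sum_range_succ, besCoeff, Nat.factorial]
  ring

theorem exists_bs_remainder : ∃ r : ℝ × ℝ → ℝ, Continuous r ∧
    ∀ x, bs (-(x.1 ^ 2 * x.2)) = 1 / 3 - x.1 ^ 2 * x.2 / 30 + x.1 ^ 4 * r x := by
  have k := continuous_powRem expDominated_besCoeff 2
  refine ⟨fun x => x.2 ^ 2 * powRem besCoeff 2 (-(x.1 ^ 2 * x.2)), by fun_prop, fun x => ?_⟩
  rw [bs_eq_two]
  ring

theorem exists_ss_remainder : ∃ r : ℝ × ℝ → ℝ, Continuous r ∧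
    ∀ x, ss (-(x.1 ^ 2 * x.2)) = 1 - x.1 ^ 2 * x.2 / 6 + x.1 ^ 4 * r x := by
  have k := continuous_powRem expDominated_sinCoeff 2
  refine ⟨fun x => x.2 ^ 2 * powRem sinCoeff 2 (-(x.1 ^ 2 * x.2)), by fun_prop, fun x => ?_⟩
  rw [ss_eq_two]
  ring

theorem exists_cs_sub_remainder : ∃ r : ℝ × ℝ → ℝ, Continuous r ∧
    ∀ x, cs (x.1 ^ 2 * (1 - x.2)) - cs (-(x.1 ^ 2 * x.2))
      = x.1 ^ 2 * (1 / 2 + x.1 ^ 2 * (1 - 2 * x.2) / 24 + x.1 ^ 4 * r x) := by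
  have k := continuous_powRem expDominated_cosCoeff 3
  refine ⟨fun x => (1 - x.2) ^ 3 * powRem cosCoeff 3 (x.1 ^ 2 * (1 - x.2))
    + x.2 ^ 3 * powRem cosCoeff 3 (-(x.1 ^ 2 * x.2)), by fun_prop, fun x => ?_⟩
  rw [cs_eq_three, cs_eq_three (-(x.1 ^ 2 * x.2))]
  ring

/-- The constant terms cancel, leaving a factor p². The witness collects all terms of order p⁶ and
higher without dividing by p, so its continuity extends to p = 0. -/
theorem exists_kerDen_remainder : ∃ r : ℝ × ℝ → ℝ, Continuous r ∧
    ∀ x, kerDen (-(x.1 ^ 2 * x.2)) (x.1 ^ 2 * (1 - x.2))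
      = x.1 ^ 2 * (1 / 2 + x.1 ^ 2 * (3 - 4 * x.2) / 24 + x.1 ^ 4 * r x) := by
  have k1 := continuous_powRem expDominated_cosCoeff 3
  have k2 := continuous_powRem expDominated_sinCoeff 2
  have k3 : Continuous cs := contDiff_cs.continuous (n := 0)
  have k4 : Continuous ss := contDiff_ss.continuous (n := 0)
  refine ⟨fun x => x.2 ^ 3 * powRem cosCoeff 3 (-(x.1 ^ 2 * x.2)) * cs (x.1 ^ 2 * (1 - x.2))
      - (1 - x.2) ^ 3 * powRem cosCoeff 3 (x.1 ^ 2 * (1 - x.2))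
        * (1 - x.1 ^ 2 * x.2 / 2 + (x.1 ^ 2 * x.2) ^ 2 / 24)
      + (x.2 * (1 - x.2) ^ 2 - x.2 ^ 2 * (1 - x.2)) / 48
      - x.1 ^ 2 * (x.2 ^ 2 * (1 - x.2) ^ 2) / 576
    + (1 - x.2) * (x.2 ^ 2 * powRem sinCoeff 2 (-(x.1 ^ 2 * x.2)) * ss (x.1 ^ 2 * (1 - x.2))
      + (1 - x.2) ^ 2 * powRem sinCoeff 2 (x.1 ^ 2 * (1 - x.2)) * (1 - x.1 ^ 2 * x.2 / 6)
      - x.2 * (1 - x.2) / 36), by fun_prop, fun x => ?_⟩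
  have hb := cs_eq_three (x.1 ^ 2 * (1 - x.2))
  have hb' := ss_eq_two (x.1 ^ 2 * (1 - x.2))
  rw [kerDen, cs_eq_three (-(x.1 ^ 2 * x.2)), ss_eq_two (-(x.1 ^ 2 * x.2))]
  linear_combination (-(1 - x.1 ^ 2 * x.2 / 2 + (x.1 ^ 2 * x.2) ^ 2 / 24)) * hb +
    (1 - x.1 ^ 2 * x.2 / 6) * (x.1 ^ 2 * (1 - x.2)) * hb'

theorem kerDen_mul_ss_pos {p y : ℝ} (hp : p ∈ Ioc (0 : ℝ) 1) (hy : y ∈ Icc (0 : ℝ) 1) :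
    0 < ss (-(p ^ 2 * y)) * kerDen (-(p ^ 2 * y)) (p ^ 2 * (1 - y)) := by
  have hpi := pi_gt_three
  have hA : -(p ^ 2 * y) = -(p * √y) ^ 2 := by rw [mul_pow, sq_sqrt hy.1]
  have hB : p ^ 2 * (1 - y) = p ^ 2 - (p * √y) ^ 2 := by rw [mul_pow, sq_sqrt hy.1]; ring
  have hy' : √y ≤ 1 := by rw [sqrt_le_one]; exact hy.2
  have h0 : 0 ≤ p * √y := mul_nonneg hp.1.le (sqrt_nonneg y)
  have h1 : p * √y ≤ p := mul_le_of_le_one_right hp.1.le hy'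
  rw [hA, hB]
  exact mul_pos (ss_pos h0 (by linarith [hp.2])) (kerDen_pos_of_le h0 h1 hp.1 (by linarith [hp.2]))

/-- The remainder of the second-order expansion of the kernel quotient in `q = p²`. -/
def kernelRem (q y r₁ r₂ r₃ r₄ : ℝ) : ℝ :=
  -(y / 30) * ((1 - 2 * y) / 24)
    - ((y / 45 - (1 - y) / 18) * (-(y / 12) + (3 - 4 * y) / 24) - y * (3 - 4 * y) / 432
      - q * ((y / 45 - (1 - y) / 18) * (y / 6) * ((3 - 4 * y) / 24)))
    + r₁ * (1 / 2 + q * (1 - 2 * y) / 24 + q ^ 2 * r₂) + (1 / 3 - q * y / 30) * r₂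
    - (1 / 3 + q * (y / 45 - (1 - y) / 18)) *
      (r₄ * (1 / 2 + q * (3 - 4 * y) / 24 + q ^ 2 * r₃) + (1 - q * y / 6) * r₃)

/-- The coefficient y/45 − (1 − y)/18 is the one for which the terms of order q cancel.
Cross-multiplying keeps this a polynomial identity. -/
theorem kernelRem_spec (q y r₁ r₂ r₃ r₄ : ℝ) :
    (1 / 3 - q * y / 30 + q ^ 2 * r₁) * (1 / 2 + q * (1 - 2 * y) / 24 + q ^ 2 * r₂)
      - (1 / 3 + q * (y / 45 - (1 - y) / 18)) *
        ((1 - q * y / 6 + q ^ 2 * r₄) * (1 / 2 + q * (3 - 4 * y) / 24 + q ^ 2 * r₃))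
    = q ^ 2 * kernelRem q y r₁ r₂ r₃ r₄ := by
  rw [kernelRem]; ring

/-- With p² removed from numerator and denominator, the error is sin t · p⁶ · R/D, where R and D are
continuous in (p, sin² t) and D has no zero on [0,1]². Compactness gives a bound uniform in t. -/
theorem exists_kernel_expansion :
    ∃ C : ℝ, ∀ p ∈ Ioc (0 : ℝ) 1, ∀ t ∈ Ioo 0 π,
      |HH p t - p ^ 2 * sin t * (1 / 3 + p ^ 2 * sin t ^ 2 / 45 - p ^ 2 * cos t ^ 2 / 18)|
        ≤ C * p ^ 6 := by
  obtain ⟨r₁, k₁, h₁⟩ := exists_bs_remainder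
  obtain ⟨r₂, k₂, h₂⟩ := exists_cs_sub_remainder
  obtain ⟨r₃, k₃, h₃⟩ := exists_kerDen_remainder
  obtain ⟨r₄, k₄, h₄⟩ := exists_ss_remainder
  obtain ⟨R, hRc, hR⟩ : ∃ R : ℝ × ℝ → ℝ, Continuous R ∧ ∀ x,
      (1 / 3 - x.1 ^ 2 * x.2 / 30 + x.1 ^ 4 * r₁ x) *
        (1 / 2 + x.1 ^ 2 * (1 - 2 * x.2) / 24 + x.1 ^ 4 * r₂ x)
      - (1 / 3 + x.1 ^ 2 * (x.2 / 45 - (1 - x.2) / 18)) * ((1 - x.1 ^ 2 * x.2 / 6 + x.1 ^ 4 * r₄ x)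
        * (1 / 2 + x.1 ^ 2 * (3 - 4 * x.2) / 24 + x.1 ^ 4 * r₃ x)) = x.1 ^ 4 * R x := by
    refine ⟨fun x => kernelRem (x.1 ^ 2) x.2 (r₁ x) (r₂ x) (r₃ x) (r₄ x), ?_, fun x => ?_⟩
    · unfold kernelRem; fun_prop
    · have := kernelRem_spec (x.1 ^ 2) x.2 (r₁ x) (r₂ x) (r₃ x) (r₄ x)
      rwa [← pow_mul] at this
  obtain ⟨D, hDc, hD⟩ : ∃ D : ℝ × ℝ → ℝ, Continuous D ∧ ∀ x,
      (1 - x.1 ^ 2 * x.2 / 6 + x.1 ^ 4 * r₄ x)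
        * (1 / 2 + x.1 ^ 2 * (3 - 4 * x.2) / 24 + x.1 ^ 4 * r₃ x) = D x :=
    ⟨_, by fun_prop, fun x => rfl⟩
  have hD' : ∀ x, ss (-(x.1 ^ 2 * x.2)) * kerDen (-(x.1 ^ 2 * x.2)) (x.1 ^ 2 * (1 - x.2))
      = x.1 ^ 2 * D x := by
    intro x
    rw [h₃, h₄, ← hD]; ring
  have hN : ∀ x, kerNum (-(x.1 ^ 2 * x.2)) (x.1 ^ 2 * (1 - x.2))
      = x.1 ^ 2 * ((1 / 3 + x.1 ^ 2 * (x.2 / 45 - (1 - x.2) / 18)) * D x + x.1 ^ 4 * R x) := by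
    intro x
    rw [kerNum, h₁, h₂, ← hR, ← hD]; ring
  have hpos : ∀ x ∈ Icc (0 : ℝ) 1 ×ˢ Icc (0 : ℝ) 1, D x ≠ 0 := by
    rintro ⟨p, y⟩ ⟨⟨hp0, hp1⟩, hy⟩
    simp only at hp0 hp1 hy
    -- At p = 0 the value of D is 1/2; for p > 0 positivity comes from that of the true denominator.
    rcases hp0.eq_or_lt with rfl | hp
    · rw [← hD]; norm_num
    · have h := kerDen_mul_ss_pos ⟨hp, hp1⟩ hy
      rw [hD' (p, y)] at h
      exact (pos_of_mul_pos_right h (sq_nonneg _)).ne'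
  obtain ⟨C, hC⟩ := (isCompact_Icc.prod isCompact_Icc).exists_bound_of_continuousOn
    (hRc.continuousOn.div hDc.continuousOn hpos)
  refine ⟨C, fun p hp t ht => ?_⟩
  have hs := sin_pos_of_mem_Ioo ht
  have hp0 := hp.1
  have hx : (p, sin t ^ 2) ∈ Icc (0 : ℝ) 1 ×ˢ Icc (0 : ℝ) 1 :=
    ⟨⟨hp.1.le, hp.2⟩, sq_nonneg _, by nlinarith [sq_nonneg (cos t), sin_sq_add_cos_sq t]⟩
  have h5 := hpos _ hx
  have h6 := hC _ hx
  have h7 := hN (p, sin t ^ 2)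
  have h8 := hD' (p, sin t ^ 2)
  have hB : (p * cos t) ^ 2 = p ^ 2 * (1 - sin t ^ 2) := by rw [mul_pow, cos_sq']
  simp only at h7 h8
  rw [HH_eq hp0.ne' hs.ne', mul_pow p (sin t), hB, h7, h8, cos_sq']
  have h9 : p ^ 2 * sin t * (p ^ 2 * ((1 / 3 + p ^ 2 * (sin t ^ 2 / 45 - (1 - sin t ^ 2) / 18))
        * D (p, sin t ^ 2) + p ^ 4 * R (p, sin t ^ 2))) / (p ^ 2 * D (p, sin t ^ 2))
      - p ^ 2 * sin t * (1 / 3 + p ^ 2 * sin t ^ 2 / 45 - p ^ 2 * (1 - sin t ^ 2) / 18)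
      = sin t * p ^ 6 * (R (p, sin t ^ 2) / D (p, sin t ^ 2)) := by
    field_simp
    ring
  rw [h9, abs_mul, abs_of_pos (by positivity), mul_comm C]
  have h10 : sin t * p ^ 6 ≤ p ^ 6 := mul_le_of_le_one_left (by positivity) (sin_le_one t)
  exact mul_le_mul h10 h6 (abs_nonneg _) (by positivity)

theorem integral_kernel_expansion (p : ℝ) :
    ∫ t in (0 : ℝ)..π, p ^ 2 * sin t * (1 / 3 + p ^ 2 * sin t ^ 2 / 45 - p ^ 2 * cos t ^ 2 / 18)
      = 2 / 3 * p ^ 2 - p ^ 4 / 135 := by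
  have hd : ∀ t, HasDerivAt
      (fun t => 7 / 270 * p ^ 4 * cos t ^ 3 - p ^ 2 * (1 / 3 + p ^ 2 / 45) * cos t)
      (p ^ 2 * sin t * (1 / 3 + p ^ 2 * sin t ^ 2 / 45 - p ^ 2 * cos t ^ 2 / 18)) t := by
    intro t
    refine ((((hasDerivAt_cos t).fun_pow 3).const_mul (7 / 270 * p ^ 4)).fun_sub
      ((hasDerivAt_cos t).const_mul (p ^ 2 * (1 / 3 + p ^ 2 / 45)))).congr_deriv ?_
    rw [sin_sq]
    push_cast
    ring
  rw [intervalIntegral.integral_eq_sub_of_hasDerivAt (fun t _ => hd t)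
    (Continuous.intervalIntegrable (by fun_prop) _ _)]
  simp only [cos_pi, cos_zero]
  ring

theorem isBigO_integral_HH :
    (fun p : ℝ => (∫ t in (0 : ℝ)..π, HH p t) - (2 / 3 * p ^ 2 - p ^ 4 / 135))
      =O[𝓝[>] 0] fun p => p ^ 6 := by
  have hpi := pi_gt_three
  obtain ⟨C, hC⟩ := exists_kernel_expansion
  refine IsBigO.of_bound (C * π) ?_
  filter_upwards [Ioo_mem_nhdsGT (one_pos : (0 : ℝ) < 1)] with p hp
  have hp' : p ∈ Ioo 0 π := ⟨hp.1, by linarith [hp.2]⟩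
  rw [← integral_kernel_expansion, ← intervalIntegral.integral_sub (integrable_HH hp')
    (Continuous.intervalIntegrable (by fun_prop) _ _)]
  have hb := intervalIntegral.norm_integral_le_of_norm_le_const_ae (a := 0) (b := π)
    (C := C * p ^ 6) (f := fun t => HH p t - p ^ 2 * sin t *
      (1 / 3 + p ^ 2 * sin t ^ 2 / 45 - p ^ 2 * cos t ^ 2 / 18)) ?_
  · refine hb.trans (le_of_eq ?_)
    rw [sub_zero, abs_of_pos pi_pos, Real.norm_eq_abs, abs_of_pos (pow_pos hp.1 6)]
    ring
  · have hne : ∀ᵐ t : ℝ, t ≠ π := by simp [ae_iff]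
    filter_upwards [hne] with t ht1 ht
    rw [uIoc_of_le pi_pos.le] at ht
    exact hC p ⟨hp.1, hp.2.le⟩ t ⟨ht.1, lt_of_le_of_ne ht.2 ht1⟩

theorem isBigO_log_one_add :
    (fun x : ℝ => log (1 + x) - (x - x ^ 2 / 2)) =O[𝓝 0] fun x => x ^ 3 := by
  -- The series remainder is at most |x|³/(1 − |x|), which is at most 2|x|³ when |x| < 1/2.
  refine IsBigO.of_bound 2 ?_
  filter_upwards [Metric.ball_mem_nhds (0 : ℝ) (by norm_num : (0 : ℝ) < 1 / 2)] with x hx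
  rw [Metric.mem_ball, dist_zero_right, Real.norm_eq_abs] at hx
  have h := Real.abs_log_sub_add_sum_range_le (x := -x) (by rw [abs_neg]; linarith) 2
  simp only [Finset.sum_range_succ, Finset.sum_range_zero, abs_neg, sub_neg_eq_add] at h
  rw [Real.norm_eq_abs, Real.norm_eq_abs, abs_pow]
  have e : log (1 + x) - (x - x ^ 2 / 2) =
      0 + (-x) ^ (0 + 1) / (((0 : ℕ) : ℝ) + 1) + (-x) ^ (1 + 1) / (((1 : ℕ) : ℝ) + 1) + log (1 + x) := by
    push_cast; ring
  rw [e]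
  refine h.trans ?_
  rw [div_le_iff₀ (by linarith)]
  have := pow_nonneg (abs_nonneg x) 3
  norm_num
  nlinarith

theorem isBigO_log_part :
    (fun p : ℝ => log (2 * cosh (p / 2) - 2 / p * sinh (p / 2))
      - (5 / 24 * p ^ 2 - 49 / 2880 * p ^ 4)) =O[𝓝[>] 0] fun p => p ^ 6 := by
  have k1 := continuous_powRem expDominated_cosCoeff 3
  have k2 := continuous_powRem expDominated_sinCoeff 3
  let h : ℝ → ℝ := fun p =>
    (2 * powRem cosCoeff 3 ((p / 2) ^ 2) - powRem sinCoeff 3 ((p / 2) ^ 2)) / 64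
  have hh : Continuous h := by fun_prop
  -- For p ≠ 0 this is the argument of the logarithm minus 1, written without division by p.
  let x : ℝ → ℝ := fun p => 5 / 24 * p ^ 2 + 3 / 640 * p ^ 4 + p ^ 6 * h p
  have hx : Continuous x := by fun_prop
  have hx0 : Tendsto x (𝓝 0) (𝓝 0) := by simpa [x] using hx.tendsto 0
  have h1 : (fun p => log (1 + x p) - (x p - x p ^ 2 / 2)) =O[𝓝 0] fun p => x p ^ 3 :=
    isBigO_log_one_add.comp_tendsto hx0
  have hbd : ∀ {f : ℝ → ℝ} (_ : Continuous f) (n : ℕ), (fun p => p ^ n * f p) =O[𝓝 0] fun p => p ^ n := by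
    intro f hf n
    simpa using (isBigO_refl (fun p : ℝ => p ^ n) (𝓝 0)).mul ((hf.tendsto 0).isBigO_one ℝ)
  have h2 : (fun p => x p ^ 3) =O[𝓝 0] fun p => p ^ 6 := by
    have := hbd (f := fun p => (5 / 24 + 3 / 640 * p ^ 2 + p ^ 4 * h p) ^ 3) (by fun_prop) 6
    refine this.congr_left fun p => ?_
    simp only [x]; ring
  have h3 : (fun p => x p - x p ^ 2 / 2 - (5 / 24 * p ^ 2 - 49 / 2880 * p ^ 4))
      =O[𝓝 0] fun p => p ^ 6 := by
    have := hbd (f := fun p => h p - (5 / 24) * (3 / 640 + p ^ 2 * h p)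
      - p ^ 2 * (3 / 640 + p ^ 2 * h p) ^ 2 / 2) (by fun_prop) 6
    refine this.congr_left fun p => ?_
    simp only [x]; ring
  have h4 := ((h1.trans h2).add h3).mono (nhdsWithin_le_nhds (s := Ioi 0))
  refine h4.congr' ?_ EventuallyEq.rfl
  filter_upwards [self_mem_nhdsWithin] with p hp
  have hp0 : p ≠ 0 := ne_of_gt hp
  have e1 : 2 * cosh (p / 2) - 2 / p * sinh (p / 2) = 1 + x p := by
    rw [← mul_ss_sq, ← cs_sq, ← mul_assoc, div_mul_div_cancel₀ hp0, div_self two_ne_zero,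
      cs_eq_three, ss_eq_three]
    simp only [x, h]
    ring
  rw [e1]
  ring

theorem isBigO_H : (fun p : ℝ => H p - (p + 1 / 4 * p ^ 2 + 23 / 864 * p ^ 4))
    =O[𝓝[>] 0] fun p => p ^ 6 := by
  refine (isBigO_integral_HH.sub (isBigO_log_part.const_mul_left 2)).congr_left fun p => ?_
  rw [H]
  ring

/-! ### Smooth extension of the integrand at p = π -/

/-- The difference quotient `(f y - f 1) / (1 - y)`, extended across `y = 1`. -/
def quotOne (f : ℝ → ℝ) (y : ℝ) : ℝ := -dslope f 1 y

theorem one_sub_mul_quotOne (f : ℝ → ℝ) (y : ℝ) : (1 - y) * quotOne f y = f y - f 1 := by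
  have := sub_smul_dslope f 1 y
  rw [smul_eq_mul] at this
  rw [quotOne, ← this]; ring

theorem analyticAt_quotOne {f : ℝ → ℝ} (hf : ∀ y, AnalyticAt ℝ f y) (y : ℝ) :
    AnalyticAt ℝ (quotOne f) y :=
  (analyticAt_dslope hf 1 y).neg

/-- `(1 + cos s) / (1 - y)` at `s² = π² y`. -/
def cosQuot : ℝ → ℝ := quotOne fun y => cs (-(π ^ 2 * y))

/-- `(cosh c - 1) / (1 - y)` at `c² = π² (1 - y)`. -/
def coshQuot : ℝ → ℝ := quotOne fun y => cs (π ^ 2 * (1 - y))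

/-- `π² sinh c / c` at `c² = π² (1 - y)`. -/
def sinhcScaled (y : ℝ) : ℝ := π ^ 2 * ss (π ^ 2 * (1 - y))

/-- The difference quotient at `1` of `π² (sin s - s cos s) / s³ - 2 * sincQuot y`, `s² = π² y`. -/
def besQuot : ℝ → ℝ := quotOne fun y => π ^ 2 * bs (-(π ^ 2 * y)) - 2 * sincQuot y

/-- `cosh c - cos s` at `s² = π² y`, `c² = π² (1 - y)`. -/
def kerM (y : ℝ) : ℝ := 2 + (1 - y) * (coshQuot y - cosQuot y)

/-- The second-order coefficient of `kerDen` in `1 - y`. -/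
def kerX (y : ℝ) : ℝ := sincQuot y * sinhcScaled y - cosQuot y * coshQuot y

/-- The numerator of the regular part of `HH π`, in terms of `y = sin² t`. -/
def regNum (y : ℝ) : ℝ := besQuot y * kerM y - 2 * (1 - y) * (sincQuot y * kerX y)

/-- The denominator of the regular part of `HH π`, in terms of `y = sin² t`. -/
def regDen (y : ℝ) : ℝ := sincQuot y * (kerM y + (1 - y) ^ 2 * kerX y)

/-- The smooth extension of the integrand of `Hpi`. -/
def regIntegrand (t : ℝ) : ℝ :=
  sin t * (regNum (sin t ^ 2) / regDen (sin t ^ 2)) - 2 / (1 + sin t)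

theorem one_sub_mul_cosQuot (y : ℝ) : (1 - y) * cosQuot y = cs (-(π ^ 2 * y)) + 1 := by
  rw [cosQuot, one_sub_mul_quotOne, mul_one, cs_neg_sq, cos_pi]; ring

theorem one_sub_mul_coshQuot (y : ℝ) : (1 - y) * coshQuot y = cs (π ^ 2 * (1 - y)) - 1 := by
  rw [coshQuot, one_sub_mul_quotOne, sub_self, mul_zero, cs_zero]

theorem pi_sq_mul_bs : π ^ 2 * bs (-π ^ 2) = 1 := by
  have h1 := pow_mul_bs π
  rw [sin_pi, cos_pi] at h1
  have h3 : π * (π ^ 2 * bs (-π ^ 2) - 1) = 0 := by linear_combination h1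
  linarith [(mul_eq_zero.mp h3).resolve_left pi_ne_zero]

theorem one_sub_mul_besQuot (y : ℝ) :
    (1 - y) * besQuot y = π ^ 2 * bs (-(π ^ 2 * y)) - 2 * sincQuot y := by
  rw [besQuot, one_sub_mul_quotOne, mul_one, pi_sq_mul_bs, sincQuot_one]; ring

theorem kerM_eq (y : ℝ) : kerM y = cs (π ^ 2 * (1 - y)) - cs (-(π ^ 2 * y)) := by
  rw [kerM]
  linear_combination one_sub_mul_coshQuot y - one_sub_mul_cosQuot y

/-- With w = 1 − y, substitute cos s = w · `cosQuot` − 1, cosh c = 1 + w · `coshQuot` and sin s / s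
= w · `sincQuot`. Thus `kerDen` agrees with cosh c − cos s up to order w², which is what cancels the
pole. -/
theorem kerM_add_eq (y : ℝ) :
    kerM y + (1 - y) ^ 2 * kerX y = kerDen (-(π ^ 2 * y)) (π ^ 2 * (1 - y)) := by
  rw [kerM_eq, kerX, kerDen, sinhcScaled]
  linear_combination (π ^ 2 * (1 - y) * ss (π ^ 2 * (1 - y))) * one_sub_mul_sincQuot y
    - (1 - y) * cosQuot y * one_sub_mul_coshQuot y
    - (cs (π ^ 2 * (1 - y)) - 1) * one_sub_mul_cosQuot y

theorem regDen_pos {y : ℝ} (h0 : 0 ≤ y) (h1 : y ≤ 1) : 0 < regDen y := by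
  have hpi := pi_pos
  refine mul_pos (sincQuot_pos h0 h1) ?_
  have h2 : √y ≤ 1 := by rw [sqrt_le_one]; exact h1
  have h3 := kerDen_pos_of_le (s := π * √y) (p := π) (by positivity) (by nlinarith) hpi le_rfl
  rw [mul_pow, sq_sqrt h0] at h3
  rw [kerM_add_eq]
  rwa [mul_sub, mul_one]

@[fun_prop]
theorem contDiff_cosQuot {n : WithTop ℕ∞} : ContDiff ℝ n cosQuot :=
  contDiff_iff_contDiffAt.mpr fun y => (analyticAt_quotOne
    (fun x => by simpa using analyticAt_scaled analyticAt_cs (-π ^ 2) x) y).contDiffAt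

@[fun_prop]
theorem contDiff_coshQuot {n : WithTop ℕ∞} : ContDiff ℝ n coshQuot :=
  contDiff_iff_contDiffAt.mpr fun y => (analyticAt_quotOne
    (fun _ => (analyticAt_cs _).comp_of_eq
      (analyticAt_const.mul (analyticAt_const.sub analyticAt_id)) rfl) y).contDiffAt

@[fun_prop]
theorem contDiff_sinhcScaled {n : WithTop ℕ∞} : ContDiff ℝ n sinhcScaled := by
  unfold sinhcScaled; fun_prop

@[fun_prop]
theorem contDiff_besQuot {n : WithTop ℕ∞} : ContDiff ℝ n besQuot := by
  refine contDiff_iff_contDiffAt.mpr fun y => (analyticAt_quotOne (fun x => ?_) y).contDiffAt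
  have h : AnalyticAt ℝ (fun y => bs (-(π ^ 2 * y))) x := by
    simpa using analyticAt_scaled analyticAt_bs (-π ^ 2) x
  exact (analyticAt_const.mul h).sub (analyticAt_const.mul (analyticAt_sincQuot x))

@[fun_prop]
theorem contDiff_regNum {n : WithTop ℕ∞} : ContDiff ℝ n regNum := by
  unfold regNum kerM kerX; fun_prop

@[fun_prop]
theorem contDiff_regDen {n : WithTop ℕ∞} : ContDiff ℝ n regDen := by
  unfold regDen kerM kerX; fun_prop

theorem contDiffOn_regIntegrand {n : WithTop ℕ∞} : ContDiffOn ℝ n regIntegrand (Icc 0 π) := by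
  intro t ht
  have h0 := sin_nonneg_of_mem_Icc ht
  have h1 := (regDen_pos (sq_nonneg (sin t)) (sin_sq_le_one t)).ne'
  refine ContDiffAt.contDiffWithinAt ?_
  unfold regIntegrand
  refine ContDiffAt.sub (ContDiffAt.mul (by fun_prop) (ContDiffAt.div (by fun_prop) (by fun_prop) h1))
    (ContDiffAt.div (by fun_prop) (by fun_prop) (by linarith))

/-- Writing π² `bs` as (1 − y) `besQuot` + 2 `sincQuot`, HH becomes sin t (2/(1 − y) +
`regNum`/`regDen`). Since 1 − y = cos² t, subtracting 2/cos² t leaves −2(1 − sin t)/(1 − sin² t) =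
−2/(1 + sin t). -/
theorem HpiIntegrand_eq {t : ℝ} (ht : t ∈ Ioo 0 π) (ht' : t ≠ π / 2) :
    HpiIntegrand t = regIntegrand t := by
  have hpi := pi_pos
  have hs := sin_pos_of_mem_Ioo ht
  have hc : cos t ≠ 0 := fun hc => ht' <|
    injOn_cos (Ioo_subset_Icc_self ht) ⟨by linarith, by linarith⟩ (by rw [hc, cos_pi_div_two])
  have hP := sincQuot_pos (sq_nonneg (sin t)) (sin_sq_le_one t)
  have hR := regDen_pos (sq_nonneg (sin t)) (sin_sq_le_one t)
  have hb := one_sub_mul_besQuot (sin t ^ 2)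
  have hsp := one_sub_mul_sincQuot (sin t ^ 2)
  have hM := kerM_eq (sin t ^ 2)
  have hE := kerM_add_eq (sin t ^ 2)
  have hw : 1 - sin t ^ 2 ≠ 0 := by rw [← cos_sq']; exact pow_ne_zero 2 hc
  have hw' : 1 + sin t ≠ 0 := by linarith
  rw [regDen] at hR
  have hE0 := pos_of_mul_pos_right hR hP.le
  rw [HpiIntegrand, HH_eq hpi.ne' hs.ne', regIntegrand, kerNum, mul_pow, mul_pow, cos_sq', ← hM,
    ← hE, ← hsp, regNum, regDen]
  have hb' : π ^ 2 * bs (-(π ^ 2 * sin t ^ 2)) =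
    (1 - sin t ^ 2) * besQuot (sin t ^ 2) + 2 * sincQuot (sin t ^ 2) := by linarith
  rw [mul_right_comm, ← mul_assoc, hb']
  generalize besQuot (sin t ^ 2) = b at *
  generalize sincQuot (sin t ^ 2) = P at *
  generalize kerM (sin t ^ 2) = M at *
  generalize kerX (sin t ^ 2) = X at *
  generalize sin t = s at *
  have h1 : 1 - s ^ 2 = (1 - s) * (1 + s) := by ring
  have h2 : 1 - s ≠ 0 := fun h => hw (by rw [h1, h, zero_mul])
  have hE1 := hE0.ne'
  rw [div_sub_div _ _ (by positivity) hw, mul_div_assoc', div_sub_div _ _ hR.ne' hw',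
    div_eq_div_iff (by positivity) (by positivity)]
  ring

theorem intervalIntegrable_regIntegrand : IntervalIntegrable regIntegrand volume 0 π := by
  refine ContinuousOn.intervalIntegrable ?_
  rw [uIcc_of_le pi_pos.le]
  exact (contDiffOn_regIntegrand (n := 0)).continuousOn

theorem ae_HpiIntegrand_eq : ∀ᵐ t : ℝ, t ∈ uIoc 0 π → HpiIntegrand t = regIntegrand t := by
  have hne : ∀ᵐ t : ℝ, t ≠ π / 2 := by simp [ae_iff]
  have hne' : ∀ᵐ t : ℝ, t ≠ π := by simp [ae_iff]
  filter_upwards [hne, hne'] with t h1 h2 ht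
  rw [uIoc_of_le pi_pos.le] at ht
  exact HpiIntegrand_eq ⟨ht.1, lt_of_le_of_ne ht.2 h2⟩ h1

theorem intervalIntegrable_HpiIntegrand : IntervalIntegrable HpiIntegrand volume 0 π := by
  refine intervalIntegrable_regIntegrand.congr_ae ?_
  rw [EventuallyEq, ae_restrict_iff' measurableSet_uIoc]
  filter_upwards [ae_HpiIntegrand_eq] with t h ht
  exact (h ht).symm

theorem integral_HpiIntegrand :
    ∫ t in (0 : ℝ)..π, HpiIntegrand t =
      (∫ t in (0 : ℝ)..π, sin t * (regNum (sin t ^ 2) / regDen (sin t ^ 2))) - 4 := by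
  have hpi := pi_pos
  have hI : ∀ t ∈ Icc 0 π, 1 + sin t ≠ 0 := fun t ht => by
    linarith [sin_nonneg_of_mem_Icc ht]
  have h1 : IntervalIntegrable (fun t => sin t * (regNum (sin t ^ 2) / regDen (sin t ^ 2)))
      volume 0 π := by
    refine Continuous.intervalIntegrable ?_ _ _
    have k1 := contDiff_regNum.continuous (n := 0)
    have k2 := contDiff_regDen.continuous (n := 0)
    refine continuous_sin.mul (Continuous.div (by fun_prop) (by fun_prop) fun t => ?_)
    exact (regDen_pos (sq_nonneg (sin t)) (sin_sq_le_one t)).ne'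
  have h2 : IntervalIntegrable (fun t => 2 / (1 + sin t)) volume 0 π := by
    refine ContinuousOn.intervalIntegrable ?_
    rw [uIcc_of_le hpi.le]
    exact ContinuousOn.div (by fun_prop) (by fun_prop) hI
  have h3 : ∫ t in (0 : ℝ)..π, 2 / (1 + sin t) = 4 := by
    have hd : ∀ t ∈ uIcc 0 π, HasDerivAt (fun t => -2 * (cos t / (1 + sin t)))
        (2 / (1 + sin t)) t := by
      intro t ht
      rw [uIcc_of_le hpi.le] at ht
      refine (((hasDerivAt_cos t).fun_div ((hasDerivAt_sin t).const_add 1) (hI t ht)).const_mul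
        (-2)).congr_deriv ?_
      have := hI t ht
      field_simp
      linear_combination sin_sq_add_cos_sq t
    rw [intervalIntegral.integral_eq_sub_of_hasDerivAt hd h2]
    norm_num
  rw [intervalIntegral.integral_congr_ae ae_HpiIntegrand_eq]
  unfold regIntegrand
  rw [intervalIntegral.integral_sub h1 h2, h3]

/-! ### Rational polynomials and Taylor models -/

/-- Evaluation at a real point of the polynomial with the listed rational coefficients. -/
def ev : List ℚ → ℝ → ℝ
  | [], _ => 0
  | a :: l, u => a + u * ev l u

/-- Sum of polynomials. -/
def padd : List ℚ → List ℚ → List ℚ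
  | [], m => m
  | a :: l, [] => a :: l
  | a :: l, b :: m => (a + b) :: padd l m

/-- Scalar multiple of a polynomial. -/
def pscale (r : ℚ) : List ℚ → List ℚ
  | [] => []
  | a :: l => (r * a) :: pscale r l

/-- Product of polynomials. -/
def pmul : List ℚ → List ℚ → List ℚ
  | [], _ => []
  | a :: l, m => padd (pscale a m) (0 :: pmul l m)

/-- The sum of the absolute values of the coefficients. -/
def pnorm : List ℚ → ℚ
  | [] => 0
  | a :: l => |a| + pnorm l

/-- The first `n` coefficients, rounded down to multiples of `10⁻¹²`. -/
def pround : ℕ → List ℚ → List ℚ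
  | 0, _ => []
  | _, [] => []
  | n + 1, a :: l => (⌊a * 10 ^ 12⌋ : ℚ) / 10 ^ 12 :: pround n l

theorem ev_padd (l m : List ℚ) (u : ℝ) : ev (padd l m) u = ev l u + ev m u := by
  induction l generalizing m with
  | nil => simp [padd, ev]
  | cons a l ih =>
    cases m with
    | nil => simp [padd, ev]
    | cons b m => simp only [padd, ev, ih]; push_cast; ring

theorem ev_pscale (r : ℚ) (l : List ℚ) (u : ℝ) : ev (pscale r l) u = r * ev l u := by
  induction l with
  | nil => simp [pscale, ev]
  | cons a l ih => simp only [pscale, ev, ih]; push_cast; ring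

theorem ev_pmul (l m : List ℚ) (u : ℝ) : ev (pmul l m) u = ev l u * ev m u := by
  induction l with
  | nil => simp [pmul, ev]
  | cons a l ih => simp only [pmul, ev, ev_padd, ev_pscale, ih]; push_cast; ring

theorem pnorm_nonneg (l : List ℚ) : 0 ≤ pnorm l := by
  induction l with
  | nil => simp [pnorm]
  | cons a l ih => simp only [pnorm]; positivity

theorem abs_ev_le (l : List ℚ) {u : ℝ} (hu : |u| ≤ 1) : |ev l u| ≤ pnorm l := by
  induction l with
  | nil => simp [ev, pnorm]
  | cons a l ih =>
    simp only [ev, pnorm]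
    push_cast
    refine (abs_add_le _ _).trans (add_le_add le_rfl ?_)
    rw [abs_mul]
    exact (mul_le_of_le_one_left (abs_nonneg _) hu).trans ih

/-- A polynomial approximant on `(-1, 1]` together with an error bound. -/
structure TaylorModel where
  /-- The coefficients of the approximant. -/
  poly : List ℚ
  /-- The error bound. -/
  err : ℚ

/-- The Taylor model `T` encloses the function `f` on `(-1, 1]`. -/
def Encloses (T : TaylorModel) (f : ℝ → ℝ) : Prop :=
  ∀ u ∈ Ioc (-1 : ℝ) 1, |f u - ev T.poly u| ≤ T.err

namespace TaylorModel

/-- An exact polynomial. -/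
def exact (l : List ℚ) : TaylorModel := ⟨l, 0⟩

/-- Sum of Taylor models. -/
def add (S T : TaylorModel) : TaylorModel := ⟨padd S.poly T.poly, S.err + T.err⟩

/-- Difference of Taylor models. -/
def sub (S T : TaylorModel) : TaylorModel := ⟨padd S.poly (pscale (-1) T.poly), S.err + T.err⟩

/-- Product of Taylor models. -/
def mul (S T : TaylorModel) : TaylorModel :=
  ⟨pmul S.poly T.poly, pnorm S.poly * T.err + S.err * (pnorm T.poly + T.err)⟩

/-- A Taylor model with rounded coefficients. -/
def round (T : TaylorModel) : TaylorModel :=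
  ⟨pround 26 T.poly, T.err + pnorm (padd T.poly (pscale (-1) (pround 26 T.poly)))⟩

end TaylorModel

theorem abs_le_one_of_mem {u : ℝ} (hu : u ∈ Ioc (-1 : ℝ) 1) : |u| ≤ 1 := abs_le.mpr ⟨hu.1.le, hu.2⟩

theorem Encloses.err_nonneg {T : TaylorModel} {f : ℝ → ℝ} (h : Encloses T f) : (0 : ℝ) ≤ T.err :=
  (abs_nonneg _).trans (h 1 ⟨by norm_num, le_rfl⟩)

theorem encloses_exact {l : List ℚ} {f : ℝ → ℝ} (h : ∀ u, f u = ev l u) :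
    Encloses (.exact l) f := fun u _ => by simp [TaylorModel.exact, h]

theorem Encloses.add {S T : TaylorModel} {f g : ℝ → ℝ} (hS : Encloses S f) (hT : Encloses T g) :
    Encloses (S.add T) fun u => f u + g u := by
  intro u hu
  simp only [TaylorModel.add, ev_padd]
  push_cast
  rw [add_sub_add_comm]
  exact (abs_add_le _ _).trans (add_le_add (hS u hu) (hT u hu))

theorem Encloses.sub {S T : TaylorModel} {f g : ℝ → ℝ} (hS : Encloses S f) (hT : Encloses T g) :
    Encloses (S.sub T) fun u => f u - g u := by
  intro u hu
  simp only [TaylorModel.sub, ev_padd, ev_pscale]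
  push_cast
  rw [show f u - g u - (ev S.poly u + -1 * ev T.poly u)
    = (f u - ev S.poly u) - (g u - ev T.poly u) by ring]
  exact (abs_sub _ _).trans (add_le_add (hS u hu) (hT u hu))

/-- From fg − PQ = P(g − Q) + (f − P)g, with |g| bounded by the norm of Q plus its error. -/
theorem Encloses.mul {S T : TaylorModel} {f g : ℝ → ℝ} (hS : Encloses S f) (hT : Encloses T g) :
    Encloses (S.mul T) fun u => f u * g u := by
  intro u hu
  have hu1 := abs_le_one_of_mem hu
  have h1 := hS u hu
  have h2 := hT u hu
  have h3 := abs_ev_le S.poly hu1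
  have h4 := abs_ev_le T.poly hu1
  have h5 : |g u| ≤ pnorm T.poly + T.err := by
    have := abs_add_le (ev T.poly u) (g u - ev T.poly u)
    rw [add_sub_cancel] at this
    linarith
  simp only [TaylorModel.mul, ev_pmul]
  push_cast
  rw [show f u * g u - ev S.poly u * ev T.poly u
    = ev S.poly u * (g u - ev T.poly u) + (f u - ev S.poly u) * g u by ring]
  refine (abs_add_le _ _).trans ?_
  rw [abs_mul, abs_mul]
  have hn : (0 : ℝ) ≤ pnorm S.poly := by exact_mod_cast pnorm_nonneg S.poly
  exact add_le_add (mul_le_mul h3 h2 (abs_nonneg _) hn)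
    (mul_le_mul h1 h5 (abs_nonneg _) hS.err_nonneg)

/-- The discarded coefficients and rounding errors are charged to the error bound. Rounding keeps
degrees and denominators small enough for exact evaluation. -/
theorem Encloses.round {T : TaylorModel} {f : ℝ → ℝ} (hT : Encloses T f) : Encloses T.round f := by
  intro u hu
  have h := abs_ev_le (padd T.poly (pscale (-1) (pround 26 T.poly))) (abs_le_one_of_mem hu)
  rw [ev_padd, ev_pscale] at h
  simp only [TaylorModel.round]
  push_cast at h ⊢
  have h2 := abs_add_le (f u - ev T.poly u) (ev T.poly u + -1 * ev (pround 26 T.poly) u)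
  rw [show f u - ev T.poly u + (ev T.poly u + -1 * ev (pround 26 T.poly) u)
    = f u - ev (pround 26 T.poly) u by ring] at h2
  linarith [hT u hu]

/-! ### Taylor models of power series in π² -/

/-- A rational approximation of `π²`. -/
def piSq : ℚ := 9869604401089 / 10 ^ 12

theorem abs_pi_sq_sub_le : |π ^ 2 - (piSq : ℝ)| ≤ 1 / 10 ^ 12 := by
  have h1 := pi_gt_d20
  have h2 := pi_lt_d20
  rw [abs_le, piSq]
  push_cast
  constructor <;> nlinarith

theorem pi_sq_le_ten : π ^ 2 ≤ 10 := by nlinarith [pi_lt_d2, pi_pos]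

theorem abs_pi_sq_pow_sub_le (k : ℕ) :
    |(π ^ 2) ^ k - (piSq : ℝ) ^ k| ≤ 1 / 10 ^ 12 * k * 10 ^ k := by
  have h := abs_pow_sub_pow_le (π ^ 2) (piSq : ℝ) k
  refine h.trans ?_
  have hm : max |π ^ 2| |(piSq : ℝ)| ≤ 10 := by
    refine max_le ?_ ?_
    · rw [abs_of_nonneg (sq_nonneg _)]; exact pi_sq_le_ten
    · rw [piSq]; norm_num [abs_of_pos]
  have h1 : max |π ^ 2| |(piSq : ℝ)| ^ (k - 1) ≤ 10 ^ k :=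
    (pow_le_pow_left₀ (le_max_of_le_left (abs_nonneg _)) hm _).trans
      (pow_le_pow_right₀ (by norm_num) (Nat.sub_le _ _))
  have := abs_pi_sq_sub_le
  gcongr

/-- The truncation of the power series in `π²` with polynomial coefficients `c k`. -/
def seriesPoly (c : ℕ → List ℚ) : ℕ → List ℚ
  | 0 => []
  | n + 1 => padd (seriesPoly c n) (pscale (piSq ^ n) (c n))

/-- The error caused by replacing `π²` by `piSq`. -/
def seriesErr (c : ℕ → List ℚ) : ℕ → ℚ
  | 0 => 0
  | n + 1 => seriesErr c n + pnorm (c n) * (1 / 10 ^ 12 * n * 10 ^ n)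

/-- Taylor model of a power series in `π²` with polynomial coefficients `c k`. -/
def TaylorModel.series (c : ℕ → List ℚ) : TaylorModel :=
  ⟨seriesPoly c 14, seriesErr c 14 + 1 / 10 ^ 10⟩

theorem abs_sum_sub_seriesPoly_le (c : ℕ → List ℚ) (n : ℕ) {u : ℝ} (hu : |u| ≤ 1) :
    |∑ k ∈ Finset.range n, ev (c k) u * (π ^ 2) ^ k - ev (seriesPoly c n) u| ≤ seriesErr c n := by
  induction n with
  | zero => simp [seriesPoly, seriesErr, ev]
  | succ n ih =>
    rw [Finset.sum_range_succ, seriesPoly, seriesErr, ev_padd, ev_pscale]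
    push_cast
    rw [show ∑ k ∈ Finset.range n, ev (c k) u * (π ^ 2) ^ k + ev (c n) u * (π ^ 2) ^ n
      - (ev (seriesPoly c n) u + (piSq : ℝ) ^ n * ev (c n) u)
      = (∑ k ∈ Finset.range n, ev (c k) u * (π ^ 2) ^ k - ev (seriesPoly c n) u)
        + ev (c n) u * ((π ^ 2) ^ n - (piSq : ℝ) ^ n) by ring]
    refine (abs_add_le _ _).trans (add_le_add ih ?_)
    rw [abs_mul]
    exact mul_le_mul (abs_ev_le _ hu) (abs_pi_sq_pow_sub_le n) (abs_nonneg _)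
      (by exact_mod_cast pnorm_nonneg _)

/-- Consecutive weights have ratio at most 1/2 from k = 14 on, so the tail is dominated by a
geometric series of sum 10⁻¹⁰. The factor 4k³ covers the coefficient bounds of every series used
below. -/
theorem tail_weight_le (j : ℕ) :
    4 * ((14 + j : ℕ) : ℝ) ^ 3 / ((2 * (14 + j)).factorial : ℝ) * 10 ^ (14 + j)
      ≤ 1 / 10 ^ 10 / 2 * (1 / 2) ^ j := by
  induction j with
  | zero => norm_num [Nat.factorial]
  | succ j ih =>
    have h1 : ((2 * (14 + (j + 1))).factorial : ℝ)
        = (2 * j + 30) * (2 * j + 29) * ((2 * (14 + j)).factorial : ℝ) := by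
      rw [show 2 * (14 + (j + 1)) = 2 * (14 + j) + 1 + 1 by ring, Nat.factorial_succ,
        Nat.factorial_succ]
      push_cast; ring
    have h2 : (0 : ℝ) < ((2 * (14 + j)).factorial : ℝ) := by positivity
    have h3 : 4 * ((14 + (j + 1) : ℕ) : ℝ) ^ 3 / ((2 * (14 + (j + 1))).factorial : ℝ)
          * 10 ^ (14 + (j + 1))
        ≤ (1 / 2) * (4 * ((14 + j : ℕ) : ℝ) ^ 3 / ((2 * (14 + j)).factorial : ℝ)
          * 10 ^ (14 + j)) := by
      rw [h1]
      push_cast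
      have hj : (0 : ℝ) ≤ j := by positivity
      have e : 4 * (14 + ((j : ℝ) + 1)) ^ 3 / ((2 * j + 30) * (2 * j + 29) * ((2 * (14 + j)).factorial : ℝ))
          * 10 ^ (14 + (j + 1)) =
          (10 * (14 + ((j : ℝ) + 1)) ^ 3 / ((2 * j + 30) * (2 * j + 29))) *
          (4 / ((2 * (14 + j)).factorial : ℝ) * 10 ^ (14 + j)) := by
        rw [← add_assoc 14 j 1, pow_succ (10 : ℝ)]
        field_simp
      rw [e, show (1 / 2) * (4 * (14 + (j : ℝ)) ^ 3 / ((2 * (14 + j)).factorial : ℝ) * 10 ^ (14 + j))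
        = (1 / 2 * (14 + (j : ℝ)) ^ 3) * (4 / ((2 * (14 + j)).factorial : ℝ) * 10 ^ (14 + j)) by ring]
      refine mul_le_mul_of_nonneg_right ?_ (by positivity)
      rw [div_le_iff₀ (by positivity)]
      nlinarith [pow_nonneg hj 2, pow_nonneg hj 3, pow_nonneg hj 4, pow_nonneg hj 5]
    refine h3.trans ?_
    rw [pow_succ (1 / 2 : ℝ)]
    linarith

/-- Two errors add up: replacing π² by `piSq` in the first 14 terms, and the tail, bounded using π²
≤ 10. -/
theorem encloses_series {c : ℕ → List ℚ} {f : ℝ → ℝ}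
    (hf : ∀ u ∈ Ioc (-1 : ℝ) 1, HasSum (fun k => ev (c k) u * (π ^ 2) ^ k) (f u))
    (hc : ∀ k ≥ 14, ∀ u ∈ Ioc (-1 : ℝ) 1,
      |ev (c k) u| ≤ 4 * (k : ℝ) ^ 3 / ((2 * k).factorial : ℝ)) :
    Encloses (.series c) f := by
  intro u hu
  have h1 := abs_sum_sub_seriesPoly_le c 14 (abs_le_one_of_mem hu)
  have h2 := (hasSum_nat_add_iff' 14).mpr (hf u hu)
  have h3 : |f u - ∑ k ∈ Finset.range 14, ev (c k) u * (π ^ 2) ^ k| ≤ 1 / 10 ^ 10 := by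
    have hg : HasSum (fun j : ℕ => (1 : ℝ) / 10 ^ 10 / 2 * (1 / 2) ^ j) (1 / 10 ^ 10) := by
      have := hasSum_geometric_two.mul_left ((1 : ℝ) / 10 ^ 10 / 2)
      convert! this using 1
      norm_num
    have h4 : ∀ j : ℕ, ‖ev (c (j + 14)) u * (π ^ 2) ^ (j + 14)‖ ≤ 1 / 10 ^ 10 / 2 * (1 / 2) ^ j := by
      intro j
      refine le_trans ?_ (tail_weight_le j)
      rw [norm_mul, Real.norm_eq_abs, Real.norm_eq_abs, abs_of_nonneg (a := (π ^ 2) ^ (j + 14)) (by positivity),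
        add_comm j 14]
      exact mul_le_mul (hc (14 + j) (by omega) u hu)
        (pow_le_pow_left₀ (sq_nonneg π) pi_sq_le_ten (14 + j)) (by positivity) (by positivity)
    have := tsum_of_norm_bounded hg h4
    rwa [h2.tsum_eq, Real.norm_eq_abs] at this
  simp only [TaylorModel.series]
  push_cast
  have h5 := abs_add_le (f u - ∑ k ∈ Finset.range 14, ev (c k) u * (π ^ 2) ^ k)
    (∑ k ∈ Finset.range 14, ev (c k) u * (π ^ 2) ^ k - ev (seriesPoly c 14) u)
  rw [sub_add_sub_cancel] at h5
  linarith

/-! ### Models of the divided differences -/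

/-- The polynomial `y = (1 - u) / 2`. -/
def yPoly : List ℚ := [1 / 2, -1 / 2]

/-- The polynomial `1 - y = (1 + u) / 2`. -/
def wPoly : List ℚ := [1 / 2, 1 / 2]

/-- The geometric sum `∑ j < k, y ^ j`. -/
def geomPoly : ℕ → List ℚ
  | 0 => []
  | k + 1 => padd [1] (pmul yPoly (geomPoly k))

/-- The sum `∑ m < k - 1, (m + 1) * y ^ m`. -/
def geomPoly₂ : ℕ → List ℚ
  | 0 => []
  | k + 1 => padd (geomPoly k) (pmul yPoly (geomPoly₂ k))

/-- The power `(1 - y) ^ k`. -/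
def wPow : ℕ → List ℚ
  | 0 => [1]
  | k + 1 => pmul wPoly (wPow k)

theorem ev_yPoly (u : ℝ) : ev yPoly u = (1 - u) / 2 := by simp [ev, yPoly]; ring
theorem ev_wPoly (u : ℝ) : ev wPoly u = 1 - (1 - u) / 2 := by simp [ev, wPoly]; ring

theorem ev_wPow (k : ℕ) (u : ℝ) : ev (wPow k) u = (1 - (1 - u) / 2) ^ k := by
  induction k with
  | zero => simp [wPow, ev]
  | succ k ih => rw [wPow, ev_pmul, ih, ev_wPoly, pow_succ']

theorem ev_geomPoly (k : ℕ) (u : ℝ) :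
    (1 - (1 - u) / 2) * ev (geomPoly k) u = 1 - ((1 - u) / 2) ^ k := by
  induction k with
  | zero => simp [geomPoly, ev]
  | succ k ih =>
    rw [geomPoly, ev_padd, ev_pmul, ev_yPoly, pow_succ']
    simp only [ev]
    push_cast
    linear_combination ((1 - u) / 2) * ih

/-- This is the second divided difference occurring in `besQuot`: a multiple of k y^(k−1) from `bs`
against the geometric sum from `sincQuot`. -/
theorem ev_geomPoly₂ (k : ℕ) (u : ℝ) :
    (1 - (1 - u) / 2) * ev (geomPoly₂ k) u = ev (geomPoly k) u - k * ((1 - u) / 2) ^ (k - 1) := by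
  induction k with
  | zero => simp [geomPoly₂, geomPoly, ev]
  | succ k ih =>
    have h1 := ev_geomPoly k u
    have h2 : (k : ℝ) * ((1 - u) / 2) ^ (k - 1) * ((1 - u) / 2) = k * ((1 - u) / 2) ^ k := by
      cases k with
      | zero => simp
      | succ k => rw [Nat.add_sub_cancel, pow_succ]; ring
    rw [geomPoly₂, geomPoly, ev_padd, ev_padd, ev_pmul, ev_pmul, ev_yPoly, Nat.add_sub_cancel]
    simp only [ev]
    push_cast
    linear_combination ((1 - u) / 2) * ih + h1 - h2

theorem half_mem {u : ℝ} (hu : u ∈ Ioc (-1 : ℝ) 1) : 0 ≤ (1 - u) / 2 ∧ (1 - u) / 2 < 1 :=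
  ⟨by linarith [hu.2], by linarith [hu.1]⟩

theorem abs_ev_wPow_le (k : ℕ) {u : ℝ} (hu : u ∈ Ioc (-1 : ℝ) 1) : |ev (wPow k) u| ≤ 1 := by
  obtain ⟨h0, h1⟩ := half_mem hu
  rw [ev_wPow, abs_of_nonneg (pow_nonneg (by linarith) k)]
  exact pow_le_one₀ (by linarith) (by linarith)

theorem ev_geomPoly_mem (k : ℕ) {u : ℝ} (hu : u ∈ Ioc (-1 : ℝ) 1) :
    0 ≤ ev (geomPoly k) u ∧ ev (geomPoly k) u ≤ k := by
  obtain ⟨h0, h1⟩ := half_mem hu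
  induction k with
  | zero => simp [geomPoly, ev]
  | succ k ih =>
    rw [geomPoly, ev_padd, ev_pmul, ev_yPoly]
    simp only [ev]
    push_cast
    have := mul_le_of_le_one_left ih.1 h1.le
    constructor
    · nlinarith [mul_nonneg h0 ih.1]
    · linarith [ih.2]

theorem ev_geomPoly₂_mem (k : ℕ) {u : ℝ} (hu : u ∈ Ioc (-1 : ℝ) 1) :
    0 ≤ ev (geomPoly₂ k) u ∧ ev (geomPoly₂ k) u ≤ (k : ℝ) ^ 2 := by
  obtain ⟨h0, h1⟩ := half_mem hu
  induction k with
  | zero => simp [geomPoly₂, ev]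
  | succ k ih =>
    have hg := ev_geomPoly_mem k hu
    rw [geomPoly₂, ev_padd, ev_pmul, ev_yPoly]
    push_cast
    have := mul_le_of_le_one_left ih.1 h1.le
    constructor
    · nlinarith [mul_nonneg h0 ih.1]
    · nlinarith [ih.2]

/-- Coefficients of `sincQuot`. -/
def sincQuotCoeff (k : ℕ) : List ℚ := pscale (-(-1) ^ k / (2 * k + 1).factorial) (geomPoly k)

/-- Coefficients of `cosQuot`. -/
def cosQuotCoeff (k : ℕ) : List ℚ := pscale (-(-1) ^ k / (2 * k).factorial) (geomPoly k)

/-- Coefficients of `coshQuot`. -/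
def coshQuotCoeff : ℕ → List ℚ
  | 0 => []
  | k + 1 => pscale (1 / (2 * k + 2).factorial) (wPow k)

/-- Coefficients of `sinhcScaled`. -/
def sinhcCoeff : ℕ → List ℚ
  | 0 => []
  | k + 1 => pscale (1 / (2 * k + 1).factorial) (wPow k)

/-- Coefficients of `besQuot`. -/
def besQuotCoeff (k : ℕ) : List ℚ := pscale (2 * (-1) ^ k / (2 * k + 1).factorial) (geomPoly₂ k)

/-- Termwise division of y^k − 1 by 1 − y. The excluded endpoint u = −1 is y = 1, where this
division is not available. -/
theorem hasSum_geomPoly {a : ℕ → ℝ} (ha : ExpDominated a) {u : ℝ} (hu : u ∈ Ioc (-1 : ℝ) 1) :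
    HasSum (fun k : ℕ => -(-1) ^ k * a k * (π ^ 2) ^ k * ev (geomPoly k) u)
      ((powSum a (-(π ^ 2 * ((1 - u) / 2))) - powSum a (-π ^ 2)) / (1 - (1 - u) / 2)) := by
  obtain ⟨h0, h1⟩ := half_mem hu
  have hw : 1 - (1 - u) / 2 ≠ 0 := by linarith
  refine hasSum_of_eq (fun k => ?_)
    (((ha.hasSum (-(π ^ 2 * ((1 - u) / 2)))).sub (ha.hasSum (-π ^ 2))).div_const _)
  have h4 := ev_geomPoly k u
  rw [eq_div_iff hw, neg_pow (π ^ 2 * ((1 - u) / 2)), neg_pow (π ^ 2) k, mul_pow]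
  linear_combination (-(-1) ^ k * a k * (π ^ 2) ^ k) * h4

theorem hasSum_sincQuot {u : ℝ} (hu : u ∈ Ioc (-1 : ℝ) 1) :
    HasSum (fun k : ℕ => -(-1) ^ k * sinCoeff k * (π ^ 2) ^ k * ev (geomPoly k) u)
      (sincQuot ((1 - u) / 2)) := by
  obtain ⟨h0, h1⟩ := half_mem hu
  have h := hasSum_geomPoly expDominated_sinCoeff hu
  rwa [← ss, ss_neg_pi_sq, sub_zero, ← one_sub_mul_sincQuot,
    mul_div_cancel_left₀ _ (by linarith)] at h

theorem encloses_sincQuot :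
    Encloses (.series sincQuotCoeff) fun u => sincQuot ((1 - u) / 2) := by
  refine encloses_series (fun u hu => ?_) (fun k hk u hu => ?_)
  · refine hasSum_of_eq (fun k => ?_) (hasSum_sincQuot hu)
    rw [sincQuotCoeff, ev_pscale, sinCoeff]
    push_cast
    ring
  · obtain ⟨h0, h1⟩ := ev_geomPoly_mem k hu
    have hk' : (1 : ℝ) ≤ k := by exact_mod_cast (by omega : 1 ≤ k)
    have hk3 : (k : ℝ) ≤ (k : ℝ) ^ 3 := le_self_pow₀ hk' (by norm_num)
    rw [sincQuotCoeff, ev_pscale, abs_mul, abs_of_nonneg h0]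
    have hf : ((2 * k).factorial : ℝ) ≤ ((2 * k + 1).factorial : ℝ) := by
      exact_mod_cast Nat.factorial_le (by omega)
    have e : |((-(-1) ^ k / (2 * k + 1).factorial : ℚ) : ℝ)| = 1 / ((2 * k + 1).factorial : ℝ) := by
      rw [Rat.cast_div, Rat.cast_natCast, abs_div, Nat.abs_cast]
      push_cast
      rw [abs_neg, abs_pow, abs_neg, abs_one, one_pow]
    rw [e, one_div_mul_eq_div]
    gcongr
    linarith

theorem encloses_cosQuot :
    Encloses (.series cosQuotCoeff) fun u => cosQuot ((1 - u) / 2) := by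
  refine encloses_series (fun u hu => ?_) (fun k hk u hu => ?_)
  · obtain ⟨h0, h1⟩ := half_mem hu
    have h := hasSum_geomPoly expDominated_cosCoeff hu
    rw [← cs, cs_neg_sq π, cos_pi, sub_neg_eq_add, ← one_sub_mul_cosQuot,
      mul_div_cancel_left₀ _ (by linarith)] at h
    refine hasSum_of_eq (fun k => ?_) h
    rw [cosQuotCoeff, ev_pscale, cosCoeff]
    push_cast
    ring
  · obtain ⟨h0, h1⟩ := ev_geomPoly_mem k hu
    have hk' : (1 : ℝ) ≤ k := by exact_mod_cast (by omega : 1 ≤ k)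
    have hk3 : (k : ℝ) ≤ (k : ℝ) ^ 3 := le_self_pow₀ hk' (by norm_num)
    rw [cosQuotCoeff, ev_pscale, abs_mul, abs_of_nonneg h0]
    have e : |((-(-1) ^ k / (2 * k).factorial : ℚ) : ℝ)| = 1 / ((2 * k).factorial : ℝ) := by
      rw [Rat.cast_div, Rat.cast_natCast, abs_div, Nat.abs_cast]
      push_cast
      rw [abs_neg, abs_pow, abs_neg, abs_one, one_pow]
    rw [e, one_div_mul_eq_div]
    gcongr
    linarith

theorem encloses_coshQuot :
    Encloses (.series coshQuotCoeff) fun u => coshQuot ((1 - u) / 2) := by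
  refine encloses_series (fun u hu => ?_) (fun k hk u hu => ?_)
  · obtain ⟨h0, h1⟩ := half_mem hu
    set y := (1 - u) / 2 with hy
    have hw : 1 - y ≠ 0 := by linarith
    have h2 := (expDominated_cosCoeff.hasSum (π ^ 2 * (1 - y))).div_const (1 - y)
    rw [← hasSum_nat_add_iff' 1] at h2 ⊢
    have h3 : powSum cosCoeff (π ^ 2 * (1 - y)) / (1 - y)
        - ∑ i ∈ Finset.range 1, cosCoeff i * (π ^ 2 * (1 - y)) ^ i / (1 - y)
        = coshQuot y - ∑ i ∈ Finset.range 1, ev (coshQuotCoeff i) u * (π ^ 2) ^ i := by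
      have h4 := one_sub_mul_coshQuot y
      change cs _ / _ - _ = _
      simp only [Finset.sum_range_one, cosCoeff, coshQuotCoeff, ev, mul_zero, Nat.factorial_zero,
        Nat.cast_one, div_one, pow_zero, mul_one, sub_zero]
      rw [← sub_div, div_eq_iff hw]
      linarith
    rw [h3] at h2
    refine hasSum_of_eq (fun k => ?_) h2
    rw [eq_div_iff hw, coshQuotCoeff, ev_pscale, ev_wPow, ← hy, cosCoeff, mul_pow, pow_succ (1 - y),
      show 2 * (k + 1) = 2 * k + 2 by ring]
    push_cast
    ring
  · obtain ⟨k, rfl⟩ : ∃ j, k = j + 1 := ⟨k - 1, by omega⟩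
    rw [coshQuotCoeff, ev_pscale, show 2 * (k + 1) = 2 * k + 2 by ring]
    push_cast
    rw [abs_mul, abs_div, abs_one, Nat.abs_cast, one_div_mul_eq_div]
    have h1 := abs_ev_wPow_le k hu
    have hk0 : (0 : ℝ) ≤ k := by positivity
    have : |ev (wPow k) u| ≤ 4 * ((k : ℝ) + 1) ^ 3 := by nlinarith [pow_nonneg hk0 2, pow_nonneg hk0 3]
    gcongr

theorem encloses_sinhcScaled :
    Encloses (.series sinhcCoeff) fun u => sinhcScaled ((1 - u) / 2) := by
  refine encloses_series (fun u hu => ?_) (fun k hk u hu => ?_)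
  · set y := (1 - u) / 2 with hy
    rw [← hasSum_nat_add_iff' 1]
    have h2 := (expDominated_sinCoeff.hasSum (π ^ 2 * (1 - y))).mul_left (π ^ 2)
    have h3 : π ^ 2 * powSum sinCoeff (π ^ 2 * (1 - y))
        = sinhcScaled y - ∑ i ∈ Finset.range 1, ev (sinhcCoeff i) u * (π ^ 2) ^ i := by
      simp only [Finset.sum_range_one, sinhcCoeff, ev, zero_mul, sub_zero]
      rfl
    rw [h3] at h2
    refine hasSum_of_eq (fun k => ?_) h2
    rw [sinhcCoeff, ev_pscale, ev_wPow, ← hy, sinCoeff, mul_pow]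
    push_cast
    ring
  · obtain ⟨k, rfl⟩ : ∃ j, k = j + 1 := ⟨k - 1, by omega⟩
    have h1 := abs_ev_wPow_le k hu
    have hk0 : (0 : ℝ) ≤ k := by positivity
    have hf : (0 : ℝ) < ((2 * k + 1).factorial : ℝ) := by positivity
    have hf' : ((2 * (k + 1)).factorial : ℝ) = (2 * k + 2) * ((2 * k + 1).factorial : ℝ) := by
      rw [show 2 * (k + 1) = 2 * k + 1 + 1 by ring, Nat.factorial_succ]; push_cast; ring
    rw [sinhcCoeff, ev_pscale, hf', Rat.cast_div, Rat.cast_natCast, Rat.cast_one, abs_mul, abs_div,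
      abs_one, Nat.abs_cast, one_div_mul_eq_div, div_le_div_iff₀ hf (by positivity)]
    push_cast
    have h2 : |ev (wPow k) u| * (2 * k + 2) ≤ 4 * ((k : ℝ) + 1) ^ 3 := by
      have := mul_le_of_le_one_left (by positivity : (0 : ℝ) ≤ 2 * k + 2) h1
      nlinarith [pow_nonneg hk0 2, pow_nonneg hk0 3]
    rw [← mul_assoc]
    exact mul_le_mul_of_nonneg_right h2 hf.le

theorem encloses_besQuot :
    Encloses (.series besQuotCoeff) fun u => besQuot ((1 - u) / 2) := by
  refine encloses_series (fun u hu => ?_) (fun k hk u hu => ?_)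
  · obtain ⟨h0, h1⟩ := half_mem hu
    set y := (1 - u) / 2 with hy
    have hw : 1 - y ≠ 0 := by linarith
    -- Since `besCoeff` k = 2(k + 1) `sinCoeff` (k + 1), a shift by one aligns this series with that
    -- of `sincQuot`. The k = 0 term vanishes, so the truncated exponent k − 1 is harmless.
    have hb : HasSum (fun k : ℕ => 2 * k * sinCoeff k * (-1) ^ (k + 1) * (π ^ 2) ^ k * y ^ (k - 1))
        (π ^ 2 * bs (-(π ^ 2 * y))) := by
      rw [← hasSum_nat_add_iff' 1]
      simp only [Finset.sum_range_one, Nat.cast_zero, mul_zero, zero_mul, sub_zero]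
      refine hasSum_of_eq (fun k => ?_)
        ((expDominated_besCoeff.hasSum (-(π ^ 2 * y))).mul_left (π ^ 2))
      rw [besCoeff, sinCoeff, neg_pow (π ^ 2 * y), mul_pow, Nat.add_sub_cancel,
        show 2 * (k + 1) + 1 = 2 * k + 3 by ring]
      push_cast
      ring
    have hP := hasSum_sincQuot hu
    rw [← hy] at hP
    have h2 := (hb.sub (hP.mul_left 2)).div_const (1 - y)
    rw [← one_sub_mul_besQuot, mul_div_cancel_left₀ _ hw] at h2
    refine hasSum_of_eq (fun k => ?_) h2
    have h4 := ev_geomPoly₂ k u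
    rw [← hy] at h4
    rw [eq_div_iff hw, besQuotCoeff, ev_pscale, sinCoeff]
    push_cast
    linear_combination (2 * (-1) ^ k / ((2 * k + 1).factorial : ℝ) * (π ^ 2) ^ k) * h4
  · obtain ⟨h0, h1⟩ := ev_geomPoly₂_mem k hu
    have hk' : (1 : ℝ) ≤ k := by exact_mod_cast (by omega : 1 ≤ k)
    have hk3 : (k : ℝ) ^ 2 ≤ (k : ℝ) ^ 3 := pow_le_pow_right₀ hk' (by norm_num)
    rw [besQuotCoeff, ev_pscale, abs_mul, abs_of_nonneg h0]
    have hf : ((2 * k).factorial : ℝ) ≤ ((2 * k + 1).factorial : ℝ) := by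
      exact_mod_cast Nat.factorial_le (by omega)
    have e : |((2 * (-1) ^ k / (2 * k + 1).factorial : ℚ) : ℝ)| = 2 / ((2 * k + 1).factorial : ℝ) := by
      rw [Rat.cast_div, Rat.cast_natCast, abs_div, Nat.abs_cast]
      push_cast
      rw [abs_mul, abs_pow, abs_neg, abs_one, one_pow, abs_two, mul_one]
    rw [e, div_mul_eq_mul_div]
    gcongr ?_ / ?_
    linarith

/-! ### Enclosure of the rational part and its integral -/

/-- Lower bound on `(-1, 1]` for the functions enclosed by a Taylor model. -/
def TaylorModel.lower : TaylorModel → ℚ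
  | ⟨[], e⟩ => -e
  | ⟨a :: l, e⟩ => a - pnorm l - e

/-- Upper bound on `(-1, 1]` for the functions enclosed by a Taylor model. -/
def TaylorModel.upper : TaylorModel → ℚ
  | ⟨[], e⟩ => e
  | ⟨a :: l, e⟩ => a + pnorm l + e

theorem Encloses.mem_bounds {T : TaylorModel} {f : ℝ → ℝ} (hT : Encloses T f) {u : ℝ}
    (hu : u ∈ Ioc (-1 : ℝ) 1) : T.lower ≤ f u ∧ f u ≤ T.upper := by
  have h := abs_le.mp (hT u hu)
  obtain ⟨_ | ⟨a, l⟩, e⟩ := T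
  · simp only [TaylorModel.lower, TaylorModel.upper, ev, sub_zero] at h ⊢
    push_cast
    exact h
  · have h1 := abs_le_one_of_mem hu
    have h2 : |u * ev l u| ≤ pnorm l := by
      rw [abs_mul]
      exact (mul_le_of_le_one_left (abs_nonneg _) h1).trans (abs_ev_le l h1)
    have h3 := abs_le.mp h2
    simp only [TaylorModel.lower, TaylorModel.upper, ev] at h ⊢
    push_cast
    constructor <;> linarith

/-- Taylor model of `sincQuot`. -/
def sincQuotModel : TaylorModel := (TaylorModel.series sincQuotCoeff).round

/-- Taylor model of `cosQuot`. -/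
def cosQuotModel : TaylorModel := (TaylorModel.series cosQuotCoeff).round

/-- Taylor model of `coshQuot`. -/
def coshQuotModel : TaylorModel := (TaylorModel.series coshQuotCoeff).round

/-- Taylor model of `sinhcScaled`. -/
def sinhcModel : TaylorModel := (TaylorModel.series sinhcCoeff).round

/-- Taylor model of `besQuot`. -/
def besQuotModel : TaylorModel := (TaylorModel.series besQuotCoeff).round

/-- Taylor model of `kerM`. -/
def kerMModel : TaylorModel :=
  (TaylorModel.exact [2]).add ((TaylorModel.exact wPoly).mul (coshQuotModel.sub cosQuotModel))

/-- Taylor model of `kerX`. -/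
def kerXModel : TaylorModel :=
  ((sincQuotModel.mul sinhcModel).sub (cosQuotModel.mul coshQuotModel)).round

/-- Taylor model of `regNum`. -/
def regNumModel : TaylorModel :=
  ((besQuotModel.mul kerMModel).sub
    (((TaylorModel.exact [2]).mul (TaylorModel.exact wPoly)).mul (sincQuotModel.mul kerXModel))).round

/-- Taylor model of `regDen`. -/
def regDenModel : TaylorModel :=
  (sincQuotModel.mul (kerMModel.add
    (((TaylorModel.exact wPoly).mul (TaylorModel.exact wPoly)).mul kerXModel))).round

/-- An approximation of `regNum / regDen` by a polynomial in `u = 1 - 2 * y`. -/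
def quotPoly : List ℚ :=
  pscale (1 / 10 ^ 9) [-192962453, -870233890, 608771833, -233997581, 37684771, 21286081, -22551386,
    11502842, -3510683, 141733, 607141, -453225, 194894, -45151, -7625, 14418, -8552, 3081, -435]

/-- Taylor model of the defect of `quotPoly`. -/
def defectModel : TaylorModel := regNumModel.sub ((TaylorModel.exact quotPoly).mul regDenModel)

theorem encloses_two : Encloses (.exact [2]) fun _ => 2 :=
  encloses_exact fun u => by simp [ev]

theorem encloses_w : Encloses (.exact wPoly) fun u => 1 - (1 - u) / 2 :=
  encloses_exact fun u => (ev_wPoly u).symm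

theorem encloses_kerM : Encloses kerMModel fun u => kerM ((1 - u) / 2) :=
  encloses_two.add (encloses_w.mul (encloses_coshQuot.round.sub encloses_cosQuot.round))

theorem encloses_kerX : Encloses kerXModel fun u => kerX ((1 - u) / 2) :=
  ((encloses_sincQuot.round.mul encloses_sinhcScaled.round).sub
    (encloses_cosQuot.round.mul encloses_coshQuot.round)).round

theorem encloses_regNum : Encloses regNumModel fun u => regNum ((1 - u) / 2) :=
  ((encloses_besQuot.round.mul encloses_kerM).sub
    ((encloses_two.mul encloses_w).mul (encloses_sincQuot.round.mul encloses_kerX))).round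

theorem encloses_regDen : Encloses regDenModel fun u => regDen ((1 - u) / 2) := by
  have h := (encloses_sincQuot.round.mul (encloses_kerM.add
    ((encloses_w.mul encloses_w).mul encloses_kerX))).round
  simp only [← pow_two] at h
  exact h

theorem encloses_defect : Encloses defectModel fun u =>
    regNum ((1 - u) / 2) - ev quotPoly u * regDen ((1 - u) / 2) :=
  encloses_regNum.sub ((encloses_exact fun _ => rfl).mul encloses_regDen)

/-- Multiplying `quotPoly` by the denominator avoids inverting a Taylor model. This exact rational
check is the only certificate of accuracy that `quotPoly` needs. -/
theorem defectModel_bounds :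
    -(1 / 10 ^ 5) ≤ defectModel.lower ∧ defectModel.upper ≤ 1 / 10 ^ 5 := by
  decide +kernel

theorem sincQuotModel_lower : 2 / 5 ≤ sincQuotModel.lower := by decide +kernel

theorem sq_div_two_le_cosh_sub_one (c : ℝ) : c ^ 2 / 2 ≤ cosh c - 1 := by
  have h : cosh c = 1 + 2 * sinh (c / 2) ^ 2 := by
    conv_lhs => rw [show c = 2 * (c / 2) by ring, cosh_two_mul, cosh_sq]
    ring
  have h2 : (c / 2) ^ 2 ≤ sinh (c / 2) ^ 2 := by
    rw [← sq_abs (c / 2), ← sq_abs (sinh (c / 2)), abs_sinh]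
    have := self_le_sinh_iff.mpr (abs_nonneg (c / 2))
    gcongr
  rw [h]
  nlinarith

/-- A bound by hand from `le_kerDen`: 1 − cos s ≥ 2y, cosh c − 1 ≥ (9/2)(1 − y) and `sincQuot` ≥
2/5. -/
theorem half_le_regDen {u : ℝ} (hu : u ∈ Ioc (-1 : ℝ) 1) : 1 / 2 ≤ regDen ((1 - u) / 2) := by
  have hP := (encloses_sincQuot.round.mem_bounds hu).1
  have hl : ((2 / 5 : ℚ) : ℝ) ≤ sincQuotModel.lower := by exact_mod_cast sincQuotModel_lower
  obtain ⟨h0, h1⟩ := half_mem hu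
  set y := (1 - u) / 2
  have hP' : 2 / 5 ≤ sincQuot y := by
    push_cast at hl
    exact hl.trans hP
  have hpi := pi_pos
  have hw : 0 < 1 - y := by linarith
  have hs : π * √y ≤ π := mul_le_of_le_one_right hpi.le (by rw [sqrt_le_one]; exact h1.le)
  have hs0 : 0 ≤ π * √y := by positivity
  have h2 := le_kerDen (π * √(1 - y)) hs0 hs
  have h3 := cos_le_one_sub_mul_cos_sq (x := π * √y) (by rwa [abs_of_nonneg hs0])
  have h4 := sq_div_two_le_cosh_sub_one (π * √(1 - y))
  have e1 : 2 / π ^ 2 * (π ^ 2 * y) = 2 * y := by field_simp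
  rw [mul_pow, mul_pow, sq_sqrt h0, sq_sqrt hw.le, ← one_sub_mul_sincQuot, ← kerM_add_eq] at h2
  rw [mul_pow, sq_sqrt h0, e1] at h3
  rw [mul_pow, sq_sqrt hw.le] at h4
  have h5 : 9 / 2 * (1 - y) ≤ cosh (π * √(1 - y)) - 1 := by
    have h9 : 9 ≤ π ^ 2 := by nlinarith [pi_gt_three]
    linarith [mul_le_mul_of_nonneg_right h9 hw.le]
  have h6 : (1 - y) * (2 / 5) * (9 / 2 * (1 - y))
      ≤ (1 - y) * sincQuot y * (cosh (π * √(1 - y)) - 1) := by gcongr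
  -- With w = 1 − y the lower bound is 2(1 − w) + (9/5)w², whose minimum 13/9 is attained at w =
  -- 5/9. Then (2/5)(5/4) = 1/2.
  have h7 : 5 / 4 ≤ kerM y + (1 - y) ^ 2 * kerX y := by nlinarith [sq_nonneg (1 - y - 5 / 9)]
  rw [regDen]
  nlinarith

theorem abs_quot_sub_le {u : ℝ} (hu : u ∈ Ioc (-1 : ℝ) 1) :
    |regNum ((1 - u) / 2) / regDen ((1 - u) / 2) - ev quotPoly u| ≤ 2 / 10 ^ 5 := by
  have hd := half_le_regDen hu
  have hd0 : regDen ((1 - u) / 2) ≠ 0 := by linarith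
  obtain ⟨h1, h2⟩ := encloses_defect.mem_bounds hu
  have hl : ((-(1 / 10 ^ 5) : ℚ) : ℝ) ≤ defectModel.lower := by exact_mod_cast defectModel_bounds.1
  have hr : (defectModel.upper : ℝ) ≤ ((1 / 10 ^ 5 : ℚ) : ℝ) := by
    exact_mod_cast defectModel_bounds.2
  push_cast at hl hr
  rw [div_sub' hd0, abs_div, abs_of_pos (by linarith : 0 < regDen ((1 - u) / 2)),
    div_le_iff₀ (by linarith), mul_comm (regDen _)]
  refine (abs_le.mpr ⟨?_, ?_⟩ : |_| ≤ (1 : ℝ) / 10 ^ 5).trans (by linarith)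
  · linarith
  · linarith

/-- The coefficients in `w` of a polynomial in `2 * w - 1`. -/
def substPoly : List ℚ → List ℚ
  | [] => []
  | a :: l => padd [a] (pmul [-1, 2] (substPoly l))

theorem ev_substPoly (l : List ℚ) (w : ℝ) : ev (substPoly l) w = ev l (2 * w - 1) := by
  induction l with
  | nil => simp [substPoly, ev]
  | cons a l ih =>
    rw [substPoly, ev_padd, ev_pmul, ih]
    simp only [ev]
    push_cast
    ring

/-- The integral over `[-1, 1]` of `x ^ (2 * m)` times a polynomial in `x ^ 2`. -/
def evenIntegral : List ℚ → ℕ → ℚ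
  | [], _ => 0
  | a :: l, m => 2 * a / (2 * m + 1) + evenIntegral l (m + 1)

@[fun_prop]
theorem continuous_ev (l : List ℚ) : Continuous (ev l) := by
  induction l with
  | nil => exact continuous_const
  | cons a l ih => exact continuous_const.add (continuous_id.mul ih)

/-- The substitution x = cos t turns each monomial into an even power integrated over [−1, 1]. -/
theorem integral_sin_mul_ev (l : List ℚ) (m : ℕ) :
    ∫ t in (0 : ℝ)..π, sin t * (cos t ^ 2) ^ m * ev l (cos t ^ 2) = evenIntegral l m := by
  induction l generalizing m with
  | nil => simp [ev, evenIntegral]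
  | cons a l ih =>
    have h1 : ∫ t in (0 : ℝ)..π, sin t * (cos t ^ 2) ^ m * a = 2 * a / (2 * m + 1) := by
      have hd : ∀ t, HasDerivAt (fun t => -(a / (2 * m + 1)) * cos t ^ (2 * m + 1))
          (sin t * (cos t ^ 2) ^ m * a) t := by
        intro t
        refine (((hasDerivAt_cos t).fun_pow (2 * m + 1)).const_mul _).congr_deriv ?_
        have : (2 * m + 1 : ℝ) ≠ 0 := by positivity
        rw [Nat.add_sub_cancel, ← pow_mul]
        push_cast
        field_simp
      rw [intervalIntegral.integral_eq_sub_of_hasDerivAt (fun t _ => hd t)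
        (Continuous.intervalIntegrable (by fun_prop) _ _)]
      rw [cos_pi, cos_zero, pow_succ, pow_mul]
      norm_num
      ring
    rw [evenIntegral]
    push_cast
    rw [← ih, ← h1, ← intervalIntegral.integral_add
      (Continuous.intervalIntegrable (by fun_prop) _ _)
      (Continuous.intervalIntegrable (by fun_prop) _ _)]
    refine intervalIntegral.integral_congr fun t _ => ?_
    simp only [ev]
    ring

theorem evenIntegral_bounds :
    880850 / 10 ^ 6 ≤ evenIntegral (substPoly quotPoly) 0 ∧
      evenIntegral (substPoly quotPoly) 0 ≤ 880865 / 10 ^ 6 := by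
  decide +kernel

theorem integral_HpiIntegrand_bounds :
    -3.1193 ≤ ∫ t in (0 : ℝ)..π, HpiIntegrand t ∧ ∫ t in (0 : ℝ)..π, HpiIntegrand t ≤ -3.1190 := by
  have hpi := pi_pos
  have hq := integral_sin_mul_ev (substPoly quotPoly) 0
  simp only [pow_zero, mul_one, ev_substPoly] at hq
  have h1 : IntervalIntegrable (fun t => sin t * (regNum (sin t ^ 2) / regDen (sin t ^ 2)))
      volume 0 π := by
    refine Continuous.intervalIntegrable ?_ _ _
    have k1 := contDiff_regNum.continuous (n := 0)
    have k2 := contDiff_regDen.continuous (n := 0)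
    refine continuous_sin.mul (Continuous.div (by fun_prop) (by fun_prop) fun t => ?_)
    exact (regDen_pos (sq_nonneg (sin t)) (sin_sq_le_one t)).ne'
  have h2 : |(∫ t in (0 : ℝ)..π, sin t * (regNum (sin t ^ 2) / regDen (sin t ^ 2)))
      - evenIntegral (substPoly quotPoly) 0| ≤ 2 / 10 ^ 5 * π := by
    rw [← hq, ← intervalIntegral.integral_sub h1
      (Continuous.intervalIntegrable (by fun_prop) _ _)]
    have hb := intervalIntegral.norm_integral_le_of_norm_le_const_ae (a := 0) (b := π)
      (C := 2 / 10 ^ 5) (f := fun t => sin t * (regNum (sin t ^ 2) / regDen (sin t ^ 2))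
        - sin t * ev quotPoly (2 * cos t ^ 2 - 1)) ?_
    · rwa [sub_zero, abs_of_pos hpi] at hb
    · have hne : ∀ᵐ t : ℝ, t ≠ π / 2 := by simp [ae_iff]
      filter_upwards [hne] with t ht1 ht
      rw [uIoc_of_le hpi.le] at ht
      have hc : cos t ≠ 0 := fun hc => ht1 <|
        injOn_cos (Ioc_subset_Icc_self ht) ⟨by linarith, by linarith⟩ (by rw [hc, cos_pi_div_two])
      have hc2 : 0 < cos t ^ 2 := by positivity
      have h3 := abs_quot_sub_le (u := 2 * cos t ^ 2 - 1)
        ⟨by linarith, by linarith [cos_sq_le_one t]⟩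
      rw [show (1 - (2 * cos t ^ 2 - 1)) / 2 = sin t ^ 2 by rw [sin_sq]; ring] at h3
      rw [← mul_sub, norm_mul, Real.norm_eq_abs, Real.norm_eq_abs]
      exact (mul_le_of_le_one_left (abs_nonneg _) (abs_sin_le_one t)).trans h3
  have hl : ((880850 / 10 ^ 6 : ℚ) : ℝ) ≤ evenIntegral (substPoly quotPoly) 0 := by
    exact_mod_cast evenIntegral_bounds.1
  have hr : (evenIntegral (substPoly quotPoly) 0 : ℝ) ≤ ((880865 / 10 ^ 6 : ℚ) : ℝ) := by
    exact_mod_cast evenIntegral_bounds.2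
  push_cast at hl hr
  have h4 := abs_le.mp h2
  have h5 := pi_lt_d2
  rw [integral_HpiIntegrand]
  constructor <;> linarith [h4.1, h4.2]

/-! ### The logarithmic term and the value of the constant -/

/-- Coefficients of `2 * cosh (π / 2) - 2 / π * sinh (π / 2)` as a series in `π²`. -/
def logArgCoeff (k : ℕ) : List ℚ :=
  [(2 / (2 * k).factorial - 1 / (2 * k + 1).factorial) / 4 ^ k]

theorem encloses_logArg :
    Encloses (.series logArgCoeff) fun _ => 2 * cosh (π / 2) - 2 / π * sinh (π / 2) := by
  have hpi := pi_pos
  refine encloses_series (fun u hu => ?_) (fun k hk u hu => ?_)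
  · have e : 2 * cosh (π / 2) - 2 / π * sinh (π / 2) = 2 * cs ((π / 2) ^ 2) - ss ((π / 2) ^ 2) := by
      rw [cs_sq, ← mul_ss_sq, ← mul_assoc, div_mul_div_cancel₀ hpi.ne', div_self two_ne_zero, one_mul]
    rw [e]
    refine hasSum_of_eq (fun k => ?_) (((expDominated_cosCoeff.hasSum _).mul_left 2).sub
      (expDominated_sinCoeff.hasSum _))
    simp only [logArgCoeff, ev, cosCoeff, sinCoeff, mul_zero, add_zero]
    rw [div_pow, div_pow, ← pow_mul 2 2 k, pow_mul 2 2 k]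
    push_cast
    norm_num
    ring
  · have hk' : (1 : ℝ) ≤ k := by exact_mod_cast (by omega : 1 ≤ k)
    have hk3 : (1 : ℝ) ≤ (k : ℝ) ^ 3 := one_le_pow₀ hk'
    have h4 : (1 : ℝ) ≤ 4 ^ k := one_le_pow₀ (by norm_num)
    have hf : ((2 * k).factorial : ℝ) ≤ ((2 * k + 1).factorial : ℝ) := by
      exact_mod_cast Nat.factorial_le (by omega)
    have hf0 : (0 : ℝ) < ((2 * k).factorial : ℝ) := by positivity
    have hf1 : 1 / ((2 * k + 1).factorial : ℝ) ≤ 1 / ((2 * k).factorial : ℝ) := by gcongr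
    have hf2 : 0 ≤ 1 / ((2 * k + 1).factorial : ℝ) := by positivity
    have e2 : 2 / ((2 * k).factorial : ℝ) = 2 * (1 / ((2 * k).factorial : ℝ)) := by ring
    have e4 : 4 * (k : ℝ) ^ 3 / ((2 * k).factorial : ℝ)
      = 4 * (k : ℝ) ^ 3 * (1 / ((2 * k).factorial : ℝ)) := by ring
    simp only [logArgCoeff, ev, mul_zero, add_zero]
    rw [Rat.cast_div, abs_div]
    push_cast
    rw [abs_of_nonneg (by linarith), abs_of_pos (by positivity : (0 : ℝ) < 4 ^ k), e4]
    refine (div_le_self (by linarith) h4).trans ?_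
    have h5 : 0 ≤ 1 / ((2 * k).factorial : ℝ) := by positivity
    nlinarith

theorem logArgModel_bounds : 355330 / 10 ^ 5 ≤ (TaylorModel.series logArgCoeff).lower ∧
    (TaylorModel.series logArgCoeff).upper ≤ 355331 / 10 ^ 5 := by
  decide +kernel

theorem log_part_bounds :
    0.6057 ≤ π - 2 * log (2 * cosh (π / 2) - 2 / π * sinh (π / 2)) ∧
      π - 2 * log (2 * cosh (π / 2) - 2 / π * sinh (π / 2)) ≤ 0.6059 := by
  obtain ⟨h1, h2⟩ := encloses_logArg.mem_bounds (u := 1) ⟨by norm_num, le_rfl⟩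
  have hl : ((355330 / 10 ^ 5 : ℚ) : ℝ) ≤ (TaylorModel.series logArgCoeff).lower := by
    exact_mod_cast logArgModel_bounds.1
  have hr : ((TaylorModel.series logArgCoeff).upper : ℝ) ≤ ((355331 / 10 ^ 5 : ℚ) : ℝ) := by
    exact_mod_cast logArgModel_bounds.2
  push_cast at hl hr
  set x := 2 * cosh (π / 2) - 2 / π * sinh (π / 2)
  have h3 := log_le_log (by norm_num) (hl.trans h1)
  have h4 := log_le_log (by linarith) (h2.trans hr)
  -- Factoring out 4 leaves log(1 − x) with x near 0.11, where six terms of the series suffice.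
  have e1 : log (355330 / 10 ^ 5 : ℝ) = 2 * log 2 + log (1 - 44670 / 400000) := by
    rw [← Real.log_rpow two_pos, ← log_mul (by positivity) (by norm_num)]; norm_num
  have e2 : log (355331 / 10 ^ 5 : ℝ) = 2 * log 2 + log (1 - 44669 / 400000) := by
    rw [← Real.log_rpow two_pos, ← log_mul (by positivity) (by norm_num)]; norm_num
  have g1 := Real.abs_log_sub_add_sum_range_le (x := (44670 / 400000 : ℝ)) (by norm_num [abs_of_pos]) 6
  have g2 := Real.abs_log_sub_add_sum_range_le (x := (44669 / 400000 : ℝ)) (by norm_num [abs_of_pos]) 6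
  rw [abs_of_pos (by norm_num : (0 : ℝ) < 44670 / 400000)] at g1
  rw [abs_of_pos (by norm_num : (0 : ℝ) < 44669 / 400000)] at g2
  have g1' := (abs_le.mp g1).1
  have g2' := (abs_le.mp g2).2
  simp only [Finset.sum_range_succ, Finset.sum_range_zero] at g1' g2'
  norm_num at g1' g2' e1 e2 h3 h4
  have := log_two_gt_d9
  have := log_two_lt_d9
  have := pi_gt_d6
  have := pi_lt_d6
  constructor <;> linarith

/-- The two enclosures add up to the interval [−2.5136, −2.5131]. -/
theorem Hpi_bounds : -2.514 < Hpi ∧ Hpi ≤ -2.513 := by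
  have h1 := log_part_bounds
  have h2 := integral_HpiIntegrand_bounds
  rw [Hpi]
  constructor <;> linarith [h1.1, h1.2, h2.1, h2.2]

end MagnusHilbert

end

theorem mainTheorem4 :
    -- the integrals defining `H p` (`0 < p < π`) and `H_π` converge
    (∀ p ∈ Ioo (0 : ℝ) π, IntervalIntegrable (MagnusHilbert.HH p) volume 0 π) ∧
    IntervalIntegrable MagnusHilbert.HpiIntegrand volume 0 π ∧
    -- (a) expansion at `0`
    ((fun p : ℝ => MagnusHilbert.H p - (p + 1 / 4 * p ^ 2 + 23 / 864 * p ^ 4))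
      =O[𝓝[>] 0] fun p : ℝ => p ^ 6) ∧
    -- (b) behaviour at `π`, in three forms
    ((fun p : ℝ => MagnusHilbert.H p - (2 * π ^ 2 / √(π ^ 2 - p ^ 2) + MagnusHilbert.Hpi))
      =o[𝓝[<] π] fun _ : ℝ => (1 : ℝ)) ∧
    ((fun p : ℝ => MagnusHilbert.H p
        - (√2 * π ^ (3 / 2 : ℝ) / √(π - p) + MagnusHilbert.Hpi))
      =o[𝓝[<] π] fun _ : ℝ => (1 : ℝ)) ∧
    ((fun p : ℝ => MagnusHilbert.H p - (p * √((π + p) / (π - p)) + MagnusHilbert.Hpi))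
      =o[𝓝[<] π] fun _ : ℝ => (1 : ℝ)) ∧
    -- the integrand of `H_π` is a smooth function of `t` on `[0, π]` (singularities removed)
    (∃ g : ℝ → ℝ, ContDiffOn ℝ ∞ g (Icc 0 π) ∧
      ∀ t ∈ Ioo (0 : ℝ) π, t ≠ π / 2 → MagnusHilbert.HpiIntegrand t = g t) ∧
    -- the decimal expansion `H_π = -2.513…`
    (-2.514 < MagnusHilbert.Hpi ∧ MagnusHilbert.Hpi ≤ -2.513) ∧
    -- (c) crude estimate
    (∃ ε : ℝ → ℝ, Tendsto ε (𝓝[>] 0) (𝓝 0) ∧ Tendsto ε (𝓝[<] π) (𝓝 0) ∧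
      ∀ p ∈ Ioo (0 : ℝ) π,
        MagnusHilbert.H p ≤ (1 + ε p) * (p * √((π + p) / (π - p)))) :=
  ⟨fun _ hp => MagnusHilbert.integrable_HH hp, MagnusHilbert.intervalIntegrable_HpiIntegrand,
    MagnusHilbert.isBigO_H, (isLittleO_one_iff ℝ).mpr MagnusHilbert.tendsto_H_sub_sqrt,
    (isLittleO_one_iff ℝ).mpr MagnusHilbert.tendsto_H_sub_rpow,
    (isLittleO_one_iff ℝ).mpr MagnusHilbert.tendsto_H_sub_mul_sqrt,
    ⟨MagnusHilbert.regIntegrand, MagnusHilbert.contDiffOn_regIntegrand,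
      fun _ ht ht' => MagnusHilbert.HpiIntegrand_eq ht ht'⟩,
    MagnusHilbert.Hpi_bounds, MagnusHilbert.exists_crude_bound MagnusHilbert.isBigO_H⟩
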